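/- Let $F$ be a field of characteristic $0$, let $K,L\ge 0$, $n=K+L+1$, and let $\mu=(K+1,1^L)$. Let $(p_1,q_1),\dots,(p_n,q_n)$ be the pairs $(0,0),(0,1),\dots,(0,K),(1,0),\dots,(L,0)$, and put $$\Delta_\mu=\det\bigl(x_i^{p_j}y_i^{q_j}\bigr)_{1\le i,j\le n}\in F[x_1,\dots,x_n,y_1,\dots,y_n].$$ Let $M_\mu$ be the linear span of all the partial derivatives (of all orders) of $\Delta_\mu$, and let $I_\mu$ be the set of polynomials $P$ with $P(\partial)\Delta_\mu=0$. A dessin consists of the following data. The places $1,\dots,n-1$ carry one column each: $K$ of them carry $y$-columns, of sizes $K,K-1,\dots,1$ from left to right, and the other $L$ carry $x$-columns, of sizes $L,L-1,\dots,1$ from left to right. In each column a number of cells, between $0$ and the size of the column, is crossed; the other cells are white. Call an $x$-column uniform if all its cells are crossed or all its cells are white. For each $y$-column that has an $x$-column to its right, consider the first (nearest) uniform $x$-column to its right; if that column is all white, the $y$-column must have at least one cross, and if it is full of crosses, the $y$-column must have at least one white cell. Let $\mathcal D$ be the set of dessins. For $D\in\mathcal D$ let $\partial_D$ be the monomial differential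 operator with one factor $\partial_{x_i}$ for each cross in an $x$-column at place $i$, and one factor $\partial_{y_i}$ for each cross in a $y$-column at place $i$; the monomial of $D$ is obtained from $\partial_D$ by replacing $\partial_{x_i},\partial_{y_i}$ with $x_i,y_i$. Then: 1. the family $\{\partial_D\Delta_\mu\}_{D\in\mathcal D}$ spans $M_\mu$; 2. every monomial in $x_1,\dots,x_n,y_1,\dots,y_n$ that is not the monomial of a dessin $D\in\mathcal D$ is the leading monomial of some element of $I_\mu$, for the lexicographic order with $x_n>\dots>x_1>y_n>\dots>y_1$. -/

import Mathlib

namespace Hook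

open MvPolynomial

/-- The variables `x_1, …, x_n` (`Sum.inl`) and `y_1, …, y_n` (`Sum.inr`), indexed from `0`. -/
abbrev Vars (n : ℕ) : Type := Fin n ⊕ Fin n

/-- The biexponents `(0,0), (0,1), …, (0,K), (1,0), …, (L,0)` of the hook `(K+1, 1^L)`,
in lexicographic order. -/
def biexponent (K L : ℕ) (j : Fin (K + L + 1)) : ℕ × ℕ :=
  if (j : ℕ) ≤ K then (0, (j : ℕ)) else ((j : ℕ) - K, 0)

/-- The biexponents are listed in strictly increasing lexicographic order. -/
theorem biexponent_strictMono (K L : ℕ) :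
    StrictMono (fun j => toLex (biexponent K L j)) := by
  intro a b hab
  have h : (a : ℕ) < b := hab
  rw [Prod.Lex.toLex_lt_toLex]
  unfold biexponent
  split_ifs <;> simp <;> omega

/-- The biexponents are exactly the (zero-based) coordinates of the cells of the Ferrers diagram
with one row of length `K+1` and `L` rows of length `1`. -/
theorem mem_hookDiagram_iff (K L : ℕ)
    (h : List.SortedGE ((K + 1) :: List.replicate L 1)) (c : ℕ × ℕ) :
    c ∈ YoungDiagram.ofRowLens ((K + 1) :: List.replicate L 1) h ↔
      ∃ j, biexponent K L j = c := by
  obtain ⟨p, q⟩ := c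
  rw [YoungDiagram.mem_ofRowLens]
  constructor
  · rintro ⟨hp, hq⟩
    rcases p with _ | p
    · simp at hq
      exact ⟨⟨q, by omega⟩, by simp [biexponent]; omega⟩
    · simp at hp hq
      exact ⟨⟨K + (p + 1), by omega⟩, by simp [biexponent, hq]⟩
  · rintro ⟨⟨j, hj⟩, hc⟩
    unfold biexponent at hc
    split_ifs at hc with hjK
    · simp at hc hjK
      obtain ⟨rfl, rfl⟩ := hc
      exact ⟨by simp, by simp; omega⟩
    · simp at hc hjK
      obtain ⟨h1, rfl⟩ := hc
      obtain ⟨t, rfl⟩ : ∃ t, p = t + 1 := ⟨p - 1, by omega⟩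
      exact ⟨by simp; omega, by simp⟩

section Polynomials

variable (F : Type*) [Field F]

/-- `Δ_μ = det (x_i^{p_j} y_i^{q_j})` for the hook `μ = (K+1, 1^L)`, with `n = K + L + 1`. -/
noncomputable def delta (K L : ℕ) : MvPolynomial (Vars (K + L + 1)) F :=
  Matrix.det (Matrix.of fun i j : Fin (K + L + 1) =>
    (X (Sum.inl i) ^ (biexponent K L j).1 * X (Sum.inr i) ^ (biexponent K L j).2 :
      MvPolynomial (Vars (K + L + 1)) F))

variable {F}

/-- The monomial differential operator
`∂_{x_1}^{p_1} ⋯ ∂_{x_n}^{p_n} ∂_{y_1}^{q_1} ⋯ ∂_{y_n}^{q_n}`, where `m = (p, q)`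
(the product in `Module.End` is composition). -/
noncomputable def monomialDeriv {n : ℕ} (m : Vars n →₀ ℕ) :
    Module.End F (MvPolynomial (Vars n) F) :=
  ((List.finRange n).map fun i =>
      ((pderiv (Sum.inl i) : Derivation F (MvPolynomial (Vars n) F) _) :
        Module.End F (MvPolynomial (Vars n) F)) ^ m (Sum.inl i)).prod *
  ((List.finRange n).map fun i =>
      ((pderiv (Sum.inr i) : Derivation F (MvPolynomial (Vars n) F) _) :
        Module.End F (MvPolynomial (Vars n) F)) ^ m (Sum.inr i)).prod

/-- The differential operator `P(∂)` attached to a polynomial `P`. -/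
noncomputable def diffOp {n : ℕ} (P : MvPolynomial (Vars n) F) :
    Module.End F (MvPolynomial (Vars n) F) :=
  ∑ m ∈ P.support, P.coeff m • monomialDeriv m

/-- The linear span of all partial derivatives (of all orders) of `f`. -/
noncomputable def derivSpan {n : ℕ} (f : MvPolynomial (Vars n) F) :
    Submodule F (MvPolynomial (Vars n) F) :=
  Submodule.span F (Set.range fun m : Vars n →₀ ℕ => monomialDeriv m f)

/-- The annihilator of `f`: all polynomials `P` with `P(∂) f = 0`. -/
def annihilator {n : ℕ} (f : MvPolynomial (Vars n) F) : Set (MvPolynomial (Vars n) F) :=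
  {P | diffOp P f = 0}

/-- Strict lexicographic order on monomials for `x_n > ⋯ > x_1 > y_n > ⋯ > y_1`. -/
def LexLT {n : ℕ} (a b : Vars n →₀ ℕ) : Prop :=
  (∃ i, a (Sum.inl i) < b (Sum.inl i) ∧ ∀ j, i < j → a (Sum.inl j) = b (Sum.inl j)) ∨
  ((∀ j, a (Sum.inl j) = b (Sum.inl j)) ∧
    ∃ i, a (Sum.inr i) < b (Sum.inr i) ∧ ∀ j, i < j → a (Sum.inr j) = b (Sum.inr j))

/-- `m` is the lexicographically leading monomial of `P`. -/
def IsLexLeading {n : ℕ} (P : MvPolynomial (Vars n) F) (m : Vars n →₀ ℕ) : Prop :=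
  m ∈ P.support ∧ ∀ m' ∈ P.support, m' ≠ m → LexLT m' m

end Polynomials

/-- The number of cells of the column at place `i`, when `Y` is the set of places of the
`y`-columns and the other places carry `x`-columns. As the `y`-columns have heights `K, …, 1` from
left to right, and the `x`-columns depths `L, …, 1`, this is the number of columns of the same
kind at the places `j ≥ i`. -/
def columnSize {N : ℕ} (Y : Finset (Fin N)) (i : Fin N) : ℕ :=
  (Finset.univ.filter fun j : Fin N => i ≤ j ∧ (j ∈ Y ↔ i ∈ Y)).card

/-- The column at place `j` is an `x`-column all of whose cells are crossed or all of whose cells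
are white, when `c j` is its number of crosses. -/
def IsUniformX {N : ℕ} (Y : Finset (Fin N)) (c : Fin N → ℕ) (j : Fin N) : Prop :=
  j ∉ Y ∧ (c j = 0 ∨ c j = columnSize Y j)

/-- Dessins (with crosses) associated with the hook `(K+1, 1^L)`: the places are `1, …, K + L`
(indexed from `0`), `Y` is the set of places of the `K` `y`-columns, and `c i` is the
number of crosses in the column at place `i`. -/
structure Dessin (K L : ℕ) where
  Y : Finset (Fin (K + L))
  card_Y : Y.card = K
  c : Fin (K + L) → ℕ
  c_le : ∀ i, c i ≤ columnSize Y i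
  /-- If `j` is the first uniform `x`-column to the right of the `y`-column `i`, then column `i`
  has a cross when column `j` is white, and a white cell when column `j` is full of crosses. -/
  rule : ∀ i j, i ∈ Y → i < j → IsUniformX Y c j →
    (∀ k, i < k → k < j → ¬ IsUniformX Y c k) →
    (c j = 0 → 0 < c i) ∧ (c j = columnSize Y j → c i < columnSize Y i)

/-- The exponent of the derivation operator `∂_D`: one `∂_{x_i}` for each cross in an `x`-column
at place `i`, one `∂_{y_i}` for each cross in a `y`-column at place `i`. -/
noncomputable def Dessin.exponent {K L : ℕ} (D : Dessin K L) : Vars (K + L + 1) →₀ ℕ :=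
  ∑ i, if i ∈ D.Y then Finsupp.single (Sum.inr i.castSucc) (D.c i)
    else Finsupp.single (Sum.inl i.castSucc) (D.c i)

end Hook

/-! Both claims follow from one fact: a monomial that leads no element of `I_μ` is the monomial of a
dessin. Claim 2 is its contrapositive. Claim 1 follows by rewriting along the lexicographic order
(`derivSpan_le_of_isReducible`).

Three families of elements of `I_μ` suffice: the products `x_i y_i` (`X_mul_X_mem`), the products of
more than `L` distinct `x`'s or `K` distinct `y`'s (`prod_X_mem`), and the elementary symmetric
polynomials of positive degree in the `x`'s or in the `y`'s (`esymm_mem`). Modulo the last family,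
the complete homogeneous `h_k` on a set `W` of variables is, up to sign, the elementary `e_k` on the
complement of `W` (`sum_finsuppAntidiag_prod`). If the degrees are large, products of such
polynomials with monomials vanish for lack of room, by the first two families. Reading off leading
monomials, `x^a y^b` is reducible unless `a` and `b` satisfy linear inequalities in `a_w`, `b_q` and
numbers of occupied places (`isReducible_of_card_lt`, `isReducible_of_left`,
`isReducible_of_right`).

These inequalities are Hall-type conditions: they allow the columns to be placed so that all crosses
fit (`exists_placement`). Among these placements, one with the `y`-columns as far right as possible
obeys the dessin rule (`exists_dessin`). -/

namespace Hook

/-! ### Placing the columns: a Hall-type criterion -/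

/-- The number of `i` with `p ≤ i < q` and `0 < a i`. -/
def supportCount (a : ℕ → ℕ) (p q : ℕ) : ℕ :=
  ((Finset.Ico p q).filter fun i => 0 < a i).card

theorem supportCount_self (a : ℕ → ℕ) (p : ℕ) : supportCount a p p = 0 := by
  simp [supportCount]

theorem supportCount_succ_left (a : ℕ → ℕ) {p q : ℕ} (h : p < q) :
    supportCount a p q = supportCount a (p + 1) q + if 0 < a p then 1 else 0 := by
  unfold supportCount
  rw [← Finset.insert_Ico_succ_left_eq_Ico h, Finset.filter_insert]
  split_ifs
  · rw [Finset.card_insert_of_notMem (by simp)]; rfl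
  · rfl

theorem supportCount_add (a : ℕ → ℕ) {p q r : ℕ} (h : p ≤ q) (h' : q ≤ r) :
    supportCount a p q + supportCount a q r = supportCount a p r := by
  unfold supportCount
  rw [← Finset.Ico_union_Ico_eq_Ico h h', Finset.filter_union, Finset.card_union_of_disjoint]
  exact Finset.disjoint_filter_filter (Finset.Ico_disjoint_Ico_consecutive p q r)

theorem supportCount_add_le {a b : ℕ → ℕ} (hab : ∀ i, a i = 0 ∨ b i = 0) (p q : ℕ) :
    supportCount a p q + supportCount b p q ≤ q - p := by
  unfold supportCount
  rw [← Finset.card_union_of_disjoint, ← Nat.card_Ico p q]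
  · exact Finset.card_le_card (Finset.union_subset (Finset.filter_subset _ _)
      (Finset.filter_subset _ _))
  · rw [Finset.disjoint_filter]
    intro i _ h
    have := hab i
    omega

theorem supportCount_le (a : ℕ → ℕ) (p q : ℕ) : supportCount a p q ≤ q - p := by
  unfold supportCount
  rw [← Nat.card_Ico p q]
  exact Finset.card_le_card (Finset.filter_subset _ _)

/-- A Hall-type criterion: the places `p, …, N - 1` can be split into `k` places carrying `y`-columns
and other places carrying `x`-columns in such a way that all crosses fit. -/
theorem exists_placement {N : ℕ} {a b : ℕ → ℕ} (hab : ∀ i, a i = 0 ∨ b i = 0)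
    (hba : ∀ q w, q ≤ w → w ≤ N → b q + a w + supportCount a q w + q ≤ N)
    (hba' : ∀ w q, w ≤ q → q ≤ N → a w + b q + supportCount b w q + w ≤ N) :
    ∀ d p k, p + d = N →
      (∀ w, p ≤ w → w ≤ N → a w + supportCount a p w + k + p ≤ N) →
      (∀ q, p ≤ q → q ≤ N → b q + supportCount b p q ≤ k) →
      ∃ Y ⊆ Finset.Ico p N, Y.card = k ∧ ∀ i, p ≤ i → i < N →
        (i ∈ Y → a i = 0 ∧ b i ≤ (Y.filter (i ≤ ·)).card) ∧
        (i ∉ Y → b i = 0 ∧ a i + (Y.filter (i ≤ ·)).card + i ≤ N) := by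
  intro d
  induction d with
  | zero =>
    intro p k hp hA _
    -- At `w = N`, one past the last place, the inequality bounds the number of columns; with no
    -- place left it forces `k = 0`.
    have := hA N (by omega) le_rfl
    refine ⟨∅, by simp, by simp; omega, ?_⟩
    intro i h1 h2
    omega
  | succ d ih =>
    intro p k hp hA hB
    have hpN : p < N := by omega
    have skip : (∀ w, p + 1 ≤ w → w ≤ N → a w + supportCount a (p + 1) w + k + (p + 1) ≤ N) →
        (∀ q, p + 1 ≤ q → q ≤ N → b q + supportCount b (p + 1) q ≤ k) → b p = 0 →
        ∃ Y ⊆ Finset.Ico p N, Y.card = k ∧ ∀ i, p ≤ i → i < N →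
          (i ∈ Y → a i = 0 ∧ b i ≤ (Y.filter (i ≤ ·)).card) ∧
          (i ∉ Y → b i = 0 ∧ a i + (Y.filter (i ≤ ·)).card + i ≤ N) := by
      intro h1 h2 hb
      obtain ⟨Y, hY, hk, hfit⟩ := ih (p + 1) k (by omega) h1 h2
      refine ⟨Y, hY.trans (Finset.Ico_subset_Ico_left (by omega)), hk, ?_⟩
      intro i hi hiN
      rcases Nat.eq_or_lt_of_le hi with rfl | hi'
      · have hp' : p ∉ Y := fun h => by have := hY h; simp at this
        refine ⟨fun h => absurd h hp', fun _ => ⟨hb, ?_⟩⟩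
        have h3 := hA p le_rfl hpN.le
        rw [supportCount_self] at h3
        have := Finset.card_filter_le Y (p ≤ ·)
        omega
      · exact hfit i hi' hiN
    have take : ∀ k', k = k' + 1 →
        (∀ w, p + 1 ≤ w → w ≤ N → a w + supportCount a (p + 1) w + k' + (p + 1) ≤ N) →
        (∀ q, p + 1 ≤ q → q ≤ N → b q + supportCount b (p + 1) q ≤ k') → a p = 0 →
        ∃ Y ⊆ Finset.Ico p N, Y.card = k ∧ ∀ i, p ≤ i → i < N →
          (i ∈ Y → a i = 0 ∧ b i ≤ (Y.filter (i ≤ ·)).card) ∧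
          (i ∉ Y → b i = 0 ∧ a i + (Y.filter (i ≤ ·)).card + i ≤ N) := by
      intro k' hk' h1 h2 ha
      obtain ⟨Y, hY, hk, hfit⟩ := ih (p + 1) k' (by omega) h1 h2
      have hp' : p ∉ Y := fun h => by have := hY h; simp at this
      refine ⟨insert p Y, ?_, ?_, ?_⟩
      · rw [Finset.insert_subset_iff]
        exact ⟨by simp [hpN], hY.trans (Finset.Ico_subset_Ico_left (by omega))⟩
      · rw [Finset.card_insert_of_notMem hp', hk, hk']
      · intro i hi hiN
        rcases Nat.eq_or_lt_of_le hi with rfl | hi'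
        · refine ⟨fun _ => ⟨ha, ?_⟩, fun h => absurd (Finset.mem_insert_self _ _) h⟩
          rw [Finset.filter_true_of_mem, Finset.card_insert_of_notMem hp', hk, ← hk']
          · have h3 := hB p le_rfl hpN.le
            rw [supportCount_self] at h3
            omega
          · intro j hj
            rcases Finset.mem_insert.1 hj with rfl | hj
            · exact le_rfl
            · have := Finset.mem_Ico.1 (hY hj)
              omega
        · have hf : (insert p Y).filter (i ≤ ·) = Y.filter (i ≤ ·) := by
            rw [Finset.filter_insert, if_neg (by omega)]
          have hm : i ∈ insert p Y ↔ i ∈ Y := by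
            rw [Finset.mem_insert]
            exact or_iff_right (by omega)
          rw [hf, hm]
          exact hfit i hi' hiN
    have hB0 := hB N hpN.le le_rfl
    by_cases hap : 0 < a p
    · have hbp : b p = 0 := by have := hab p; omega
      apply skip _ _ hbp
      · intro w h1 h2
        have := hA w (by omega) h2
        rw [supportCount_succ_left a (by omega), if_pos hap] at this
        omega
      · intro q h1 h2
        have := hB q (by omega) h2
        rwa [supportCount_succ_left b (by omega), if_neg (by omega)] at this
    by_cases hbp : 0 < b p
    · obtain ⟨k', rfl⟩ : ∃ k', k = k' + 1 := ⟨k - 1, by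
        rw [supportCount_succ_left b (by omega), if_pos hbp] at hB0; omega⟩
      apply take k' rfl _ _ (by omega)
      · intro w h1 h2
        have := hA w (by omega) h2
        rw [supportCount_succ_left a (by omega), if_neg hap] at this
        omega
      · intro q h1 h2
        have := hB q (by omega) h2
        rw [supportCount_succ_left b (by omega), if_pos hbp] at this
        omega
    have hA' : ∀ w, p + 1 ≤ w → w ≤ N → a w + supportCount a (p + 1) w + k + p ≤ N := by
      intro w h1 h2
      have := hA w (by omega) h2
      rwa [supportCount_succ_left a (by omega), if_neg hap] at this
    have hB' : ∀ q, p + 1 ≤ q → q ≤ N → b q + supportCount b (p + 1) q ≤ k := by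
      intro q h1 h2
      have := hB q (by omega) h2
      rwa [supportCount_succ_left b (by omega), if_neg hbp] at this
    -- An empty place receives an `x`-column whenever the crosses of `a` still fit afterwards.
    -- Otherwise some `w` is tight.
    by_cases hs : ∀ w, p + 1 ≤ w → w ≤ N → a w + supportCount a (p + 1) w + k + (p + 1) ≤ N
    · exact skip hs hB' (by omega)
    push Not at hs
    obtain ⟨w, hw, hwN, hlt⟩ := hs
    -- The supports of `a` and `b` are disjoint, so the places before `min q w` are counted at most
    -- once. Against the tight `w`, this bound leaves one unit of slack on the `b` side, which
    -- permits a `y`-column at `p`.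
    have pair : ∀ q, p + 1 ≤ q → q ≤ N →
        a w + supportCount a (p + 1) w + (b q + supportCount b (p + 1) q) + (p + 1) ≤ N := by
      intro q hq hqN
      rcases le_total q w with hqw | hwq
      · have h1 := hba q w hqw hwN
        have h2 := supportCount_add a hq hqw
        have h3 := supportCount_add_le hab (p + 1) q
        omega
      · have h1 := hba' w q hwq hqN
        have h2 := supportCount_add b hw hwq
        have h3 := supportCount_add_le hab (p + 1) w
        omega
    have hw' := hA' w hw hwN
    have h0 := pair N (by omega) le_rfl
    refine take (k - 1) (by omega) (fun w' h1 h2 => ?_) (fun q h1 h2 => ?_) (by omega)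
    · have := hA' w' h1 h2
      omega
    · have := pair q h1 h2
      omega

/-! ### From placements to dessins -/

/-- The crosses given by `a` (in `x`-columns) and `b` (in `y`-columns) fit into the columns
determined by the set `Y` of places of the `y`-columns. -/
structure Fits {N : ℕ} (K : ℕ) (a b : ℕ → ℕ) (Y : Finset (Fin N)) : Prop where
  card_eq : Y.card = K
  left_eq_zero : ∀ i : Fin N, i ∈ Y → a i = 0
  right_eq_zero : ∀ i : Fin N, i ∉ Y → b i = 0
  add_le : ∀ i : Fin N, a i + b i ≤ columnSize Y i

theorem columnSize_of_mem {N : ℕ} {Y : Finset (Fin N)} {i : Fin N} (h : i ∈ Y) :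
    columnSize Y i = (Finset.univ.filter fun j => i ≤ j ∧ j ∈ Y).card := by
  simp [columnSize, h]

theorem columnSize_of_notMem {N : ℕ} {Y : Finset (Fin N)} {i : Fin N} (h : i ∉ Y) :
    columnSize Y i = (Finset.univ.filter fun j => i ≤ j ∧ j ∉ Y).card := by
  simp [columnSize, h]

theorem columnSize_pos {N : ℕ} (Y : Finset (Fin N)) (i : Fin N) : 0 < columnSize Y i :=
  Finset.card_pos.2 ⟨i, by simp⟩

theorem card_filter_ge_add {N : ℕ} (Y : Finset (Fin N)) (i : Fin N) :
    (Finset.univ.filter fun j => i ≤ j ∧ j ∈ Y).card +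
      (Finset.univ.filter fun j => i ≤ j ∧ j ∉ Y).card + i = N := by
  rw [← Finset.filter_filter, ← Finset.filter_filter, Finset.card_filter_add_card_filter_not]
  have : (Finset.univ.filter fun j => i ≤ j) = Finset.Ici i := by ext; simp
  rw [this, Fin.card_Ici]
  omega

theorem exists_fits {K L : ℕ} {a b : ℕ → ℕ} (hab : ∀ i, a i = 0 ∨ b i = 0)
    (hba : ∀ q w, q ≤ w → w ≤ K + L → b q + a w + supportCount a q w + q ≤ K + L)
    (hba' : ∀ w q, w ≤ q → q ≤ K + L → a w + b q + supportCount b w q + w ≤ K + L)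
    (hA : ∀ w, w ≤ K + L → a w + supportCount a 0 w ≤ L)
    (hB : ∀ q, q ≤ K + L → b q + supportCount b 0 q ≤ K) :
    ∃ Y : Finset (Fin (K + L)), Fits K a b Y := by
  obtain ⟨Y, hY, hc, h⟩ := exists_placement hab hba hba' (K + L) 0 K (by omega)
    (fun w _ hw => by have := hA w hw; omega) (fun q _ hq => hB q hq)
  have hmap : ∀ P : ℕ → Prop, ∀ [DecidablePred P],
      (Finset.univ.filter fun j : Fin (K + L) => P j ∧ (j : ℕ) ∈ Y).card = (Y.filter P).card := by
    intro P _
    refine Finset.card_bij (fun j _ => (j : ℕ)) ?_ ?_ ?_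
    · simp +contextual
    · intro i _ j _ hij
      exact Fin.ext hij
    · intro j hj
      rw [Finset.mem_filter] at hj
      have := Finset.mem_Ico.1 (hY hj.1)
      exact ⟨⟨j, this.2⟩, by simp [hj], rfl⟩
  refine ⟨Finset.univ.filter fun j => (j : ℕ) ∈ Y, ?_, ?_, ?_, ?_⟩
  · have := hmap (fun _ => True)
    simpa [hc] using this
  · intro i hi
    exact ((h i (by omega) i.2).1 (by simpa using hi)).1
  · intro i hi
    exact ((h i (by omega) i.2).2 (by simpa using hi)).1
  · intro i
    have h1 := hmap (fun j => (i : ℕ) ≤ j)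
    have h2 := card_filter_ge_add (Finset.univ.filter fun j : Fin (K + L) => (j : ℕ) ∈ Y) i
    by_cases hi : (i : ℕ) ∈ Y
    · have h3 := (h i (by omega) i.2).1 hi
      rw [columnSize_of_mem (by simpa using hi)]
      simp only [Finset.mem_filter, Finset.mem_univ, true_and, Fin.le_def]
      omega
    · have h3 := (h i (by omega) i.2).2 hi
      rw [columnSize_of_notMem (by simpa using hi)]
      simp only [Finset.mem_filter, Finset.mem_univ, true_and, Fin.le_def] at h2 ⊢
      omega

/-- Exchanging an empty `y`-column with the first uniform `x`-column to its right, if that column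
is white, gives another way to place the columns. -/
theorem Fits.swap {N K : ℕ} {a b : ℕ → ℕ} {Y : Finset (Fin N)} (h : Fits K a b Y) {i j : Fin N}
    (hi : i ∈ Y) (hij : i < j) (hj : j ∉ Y)
    (hu : ∀ k, i < k → k < j → ¬ IsUniformX Y (fun k : Fin N => a k + b k) k)
    (hai : b i = 0) (haj : a j = 0) : Fits K a b (insert j (Y.erase i)) := by
  have hbj := h.right_eq_zero j hj
  have hmem : ∀ k, k ∈ insert j (Y.erase i) ↔ k = j ∨ k ≠ i ∧ k ∈ Y := by simp
  refine ⟨?_, ?_, ?_, ?_⟩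
  · rw [Finset.card_insert_of_notMem (by simp [hj]), Finset.card_erase_add_one hi, h.card_eq]
  · intro k hk
    rcases (hmem k).1 hk with rfl | ⟨_, hk⟩
    · exact haj
    · exact h.left_eq_zero k hk
  · intro k hk
    rw [hmem] at hk
    push Not at hk
    by_cases hki : k = i
    · rw [hki, hai]
    · exact h.right_eq_zero k (hk.2 hki)
  · intro k
    have hk := h.add_le k
    by_cases hki : k = i
    · rw [hki, h.left_eq_zero i hi, hai]
      exact Nat.zero_le _
    by_cases hkj : k = j
    · rw [hkj, haj, hbj]
      exact Nat.zero_le _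
    have hkm : k ∈ insert j (Y.erase i) ↔ k ∈ Y := by simp [hki, hkj]
    by_cases hkY : k ∈ Y
    · rw [columnSize_of_mem hkY] at hk
      rw [columnSize_of_mem (hkm.2 hkY)]
      rcases lt_or_ge i k with hik | hik
      · refine hk.trans (Finset.card_le_card ?_)
        intro l
        simp only [Finset.mem_filter, Finset.mem_univ, true_and, hmem]
        rintro ⟨h1, h2⟩
        exact ⟨h1, Or.inr ⟨(hik.trans_le h1).ne', h2⟩⟩
      · refine hk.trans (le_of_eq ?_)
        have : (Finset.univ.filter fun l => k ≤ l ∧ l ∈ insert j (Y.erase i)) =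
            insert j ((Finset.univ.filter fun l => k ≤ l ∧ l ∈ Y).erase i) := by
          ext l
          simp only [Finset.mem_filter, Finset.mem_univ, true_and, hmem, Finset.mem_insert,
            Finset.mem_erase]
          constructor
          · tauto
          · rintro (rfl | h)
            · exact ⟨hik.trans hij.le, Or.inl rfl⟩
            · tauto
        rw [this, Finset.card_insert_of_notMem (by simp [hj]), Finset.card_erase_add_one]
        simp [hik, hi]
    · rw [columnSize_of_notMem hkY] at hk
      have hkY' := mt hkm.1 hkY
      rw [columnSize_of_notMem hkY']
      rcases lt_or_ge j k with hjk | hjk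
      · refine hk.trans (Finset.card_le_card ?_)
        intro l
        simp only [Finset.mem_filter, Finset.mem_univ, true_and, hmem]
        rintro ⟨h1, h2⟩
        refine ⟨h1, ?_⟩
        rintro (rfl | h3)
        · exact absurd h1 (not_le.2 hjk)
        · exact h2 h3.2
      have hjk : k < j := lt_of_le_of_ne hjk hkj
      have key : (Finset.univ.filter fun l => k ≤ l ∧ l ∉ Y).erase j ⊆
          Finset.univ.filter fun l => k ≤ l ∧ l ∉ insert j (Y.erase i) := by
        intro l
        simp only [Finset.mem_filter, Finset.mem_univ, true_and, hmem, Finset.mem_erase]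
        tauto
      have hcard := Finset.card_erase_add_one (s := Finset.univ.filter fun l => k ≤ l ∧ l ∉ Y)
        (a := j) (by simp [hjk.le, hj])
      have hle := Finset.card_le_card key
      rcases lt_or_ge i k with hik | hik
      · have hnu := hu k hik hjk
        simp only [IsUniformX, hkY, not_false_eq_true, true_and, not_or,
          columnSize_of_notMem hkY] at hnu
        omega
      · have hik : k < i := lt_of_le_of_ne hik hki
        have key' : insert i ((Finset.univ.filter fun l => k ≤ l ∧ l ∉ Y).erase j) ⊆
            Finset.univ.filter fun l => k ≤ l ∧ l ∉ insert j (Y.erase i) := by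
          rw [Finset.insert_subset_iff]
          exact ⟨by simp [hik.le, hij.ne], key⟩
        have hle' := Finset.card_le_card key'
        rw [Finset.card_insert_of_notMem (by simp [hi])] at hle'
        omega

/-- Maximising the sum of the places of the `y`-columns enforces the rule for white columns, since
`Fits.swap` would increase that sum. The rule for full columns needs no maximality: a full
`y`-column followed by a full first uniform `x`-column contradicts the strict inequality `hlt`. -/
theorem exists_dessin {K L : ℕ} {a b : ℕ → ℕ} (hab : ∀ i, a i = 0 ∨ b i = 0)
    (hba : ∀ q w, q ≤ w → w ≤ K + L → b q + a w + supportCount a q w + q ≤ K + L)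
    (hba' : ∀ w q, w ≤ q → q ≤ K + L → a w + b q + supportCount b w q + w ≤ K + L)
    (hA : ∀ w, w ≤ K + L → a w + supportCount a 0 w ≤ L)
    (hB : ∀ q, q ≤ K + L → b q + supportCount b 0 q ≤ K)
    (hlt : ∀ q w, q < w → w < K + L → 0 < b q → 0 < a w →
      b q + a w + supportCount a (q + 1) w + q < K + L) :
    ∃ D : Dessin K L, (∀ i : Fin (K + L), i ∈ D.Y → a i = 0 ∧ D.c i = b i) ∧
      ∀ i : Fin (K + L), i ∉ D.Y → b i = 0 ∧ D.c i = a i := by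
  classical
  obtain ⟨Y₀, hY₀⟩ := exists_fits hab hba hba' hA hB
  obtain ⟨Y, hY, hmax⟩ := Finset.exists_max_image
    (Finset.univ.filter fun Y : Finset (Fin (K + L)) => Fits K a b Y)
    (fun Y => ∑ i ∈ Y, (i : ℕ)) ⟨Y₀, by simpa using hY₀⟩
  simp only [Finset.mem_filter, Finset.mem_univ, true_and] at hY hmax
  refine ⟨⟨Y, hY.card_eq, fun i : Fin (K + L) => a i + b i, hY.add_le, ?_⟩, ?_, ?_⟩
  · intro i j hi hij hj hu
    have hai := hY.left_eq_zero i hi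
    have hbj := hY.right_eq_zero j hj.1
    constructor
    · intro h0
      by_contra hc
      have hf := hmax _ (hY.swap hi hij hj.1 hu (by omega) (by omega))
      rw [Finset.sum_insert (by simp [hj.1])] at hf
      have := Finset.add_sum_erase Y (fun i => (i : ℕ)) hi
      have : (i : ℕ) < j := hij
      omega
    · intro hj'
      by_contra hc
      have hi' := hY.add_le i
      have p1 := columnSize_pos Y i
      have p2 := columnSize_pos Y j
      have h1 := hlt i j hij j.2 (by omega) (by omega)
      have h2 := card_filter_ge_add Y i
      rw [columnSize_of_mem hi] at hc
      rw [columnSize_of_notMem hj.1] at hj'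
      -- An `x`-column strictly between `i` and `j` is not uniform, so it has a cross and is counted
      -- by `supportCount`.
      have h3 : (Finset.univ.filter fun l => i ≤ l ∧ l ∉ Y).card ≤
          (Finset.univ.filter fun l => j ≤ l ∧ l ∉ Y).card + supportCount a (i + 1) j := by
        have : (Finset.univ.filter fun l => i ≤ l ∧ l ∉ Y) ⊆
            (Finset.univ.filter fun l => j ≤ l ∧ l ∉ Y) ∪
            Finset.univ.filter fun l : Fin (K + L) => (i < l ∧ l < j) ∧ 0 < a l := by
          intro l
          simp only [Finset.mem_filter, Finset.mem_univ, true_and, Finset.mem_union]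
          rintro ⟨hl, hlY⟩
          rcases le_or_gt j l with h | h
          · exact Or.inl ⟨h, hlY⟩
          · have hil : i < l := lt_of_le_of_ne hl (by rintro rfl; exact hlY hi)
            refine Or.inr ⟨⟨hil, h⟩, ?_⟩
            have hnu := hu l hil h
            simp only [IsUniformX, hlY, not_false_eq_true, true_and, not_or,
              hY.right_eq_zero l hlY] at hnu
            omega
        refine (Finset.card_le_card this).trans ((Finset.card_union_le _ _).trans ?_)
        refine Nat.add_le_add_left ?_ _
        refine Finset.card_le_card_of_injOn (fun l => (l : ℕ)) ?_
          (fun _ _ _ _ h => Fin.ext h)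
        intro l
        simp only [Finset.coe_filter, Finset.mem_univ, true_and, Set.mem_ofPred_eq,
          Finset.mem_Ico, Fin.lt_def]
        omega
      omega
  · intro i hi
    have := hY.left_eq_zero i hi
    exact ⟨this, by simp [this]⟩
  · intro i hi
    have := hY.right_eq_zero i hi
    exact ⟨this, by simp [this]⟩

open MvPolynomial

/-! ### Differential operators as the image of a polynomial ring -/

section Operators

variable {F : Type*} [Field F] {n : ℕ}

/-- The partial derivatives as endomorphisms. -/
noncomputable def pderivEnd (v : Vars n) : Module.End F (MvPolynomial (Vars n) F) :=
  ((pderiv v : Derivation F (MvPolynomial (Vars n) F) _) :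
        Module.End F (MvPolynomial (Vars n) F))

theorem pderivEnd_apply (v : Vars n) (f : MvPolynomial (Vars n) F) :
    pderivEnd v f = pderiv v f := rfl

theorem pderivEnd_mul_comm (v w : Vars n) :
    pderivEnd (F := F) v * pderivEnd w = pderivEnd w * pderivEnd v := by
  refine MvPolynomial.linearMap_ext fun s => LinearMap.ext_ring ?_
  simp only [LinearMap.comp_apply, Module.End.mul_apply, pderivEnd_apply, pderiv_monomial]
  rw [tsub_right_comm]
  congr 1
  by_cases h : v = w
  · rw [h]
  · simp [h, Ne.symm h]
    ring

/-- The commutative algebra generated by the partial derivatives. -/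
noncomputable abbrev derivAlgebra (F : Type*) [Field F] (n : ℕ) :
    Subalgebra F (Module.End F (MvPolynomial (Vars n) F)) :=
  Algebra.adjoin F (Set.range pderivEnd)

/-- Polynomials can only be evaluated in a commutative algebra, and the full endomorphism ring is
not one; hence the passage through this subalgebra. -/
instance : IsMulCommutative (derivAlgebra F n) :=
  Algebra.isMulCommutative_adjoin F (by
    rintro _ ⟨v, rfl⟩ _ ⟨w, rfl⟩
    exact pderivEnd_mul_comm v w)

open scoped IsMulCommutative in
/-- The substitution `P ↦ P(∂)` as a homomorphism of algebras. -/
noncomputable def derivHom :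
    MvPolynomial (Vars n) F →ₐ[F] Module.End F (MvPolynomial (Vars n) F) :=
  (derivAlgebra F n).val.comp
    (aeval fun v => ⟨pderivEnd v, Algebra.subset_adjoin (Set.mem_range_self v)⟩)

theorem derivHom_X (v : Vars n) : derivHom (F := F) (X v) = pderivEnd v := by
  simp [derivHom]

theorem derivHom_monomial (m : Vars n →₀ ℕ) :
    derivHom (F := F) (monomial m 1) = monomialDeriv m := by
  have : (monomial m 1 : MvPolynomial (Vars n) F) =
      ((List.finRange n).map fun i => X (Sum.inl i) ^ m (Sum.inl i)).prod *
        ((List.finRange n).map fun i => X (Sum.inr i) ^ m (Sum.inr i)).prod := by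
    rw [← Fin.prod_univ_def, ← Fin.prod_univ_def, monomial_eq, Finsupp.prod_fintype _ _ (by simp),
      Fintype.prod_sum_type]
    simp
  rw [this, map_mul, map_list_prod, map_list_prod, List.map_map, List.map_map]
  unfold monomialDeriv
  congr 3 <;>
  · funext i
    simp [derivHom_X, pderivEnd]

theorem diffOp_eq_derivHom (P : MvPolynomial (Vars n) F) : diffOp P = derivHom P := by
  conv_rhs => rw [P.as_sum]
  rw [map_sum, diffOp]
  refine Finset.sum_congr rfl fun m _ => ?_
  rw [← derivHom_monomial, ← map_smul, smul_monomial, smul_eq_mul, mul_one]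

/-- The annihilator of `f` as an ideal. -/
noncomputable def annihilatorIdeal (f : MvPolynomial (Vars n) F) :
    Ideal (MvPolynomial (Vars n) F) where
  carrier := {P | derivHom P f = 0}
  add_mem' {P Q} hP hQ := by
    simp only [Set.mem_ofPred_eq] at *
    rw [map_add, LinearMap.add_apply, hP, hQ, add_zero]
  zero_mem' := by simp
  smul_mem' P Q hQ := by
    simp only [Set.mem_ofPred_eq] at *
    rw [smul_eq_mul, map_mul, Module.End.mul_apply, hQ, map_zero]

theorem mem_annihilatorIdeal {f P : MvPolynomial (Vars n) F} :
    P ∈ annihilatorIdeal f ↔ derivHom P f = 0 := Iff.rfl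

theorem mem_annihilator_iff {f P : MvPolynomial (Vars n) F} :
    P ∈ annihilator f ↔ P ∈ annihilatorIdeal f := by
  rw [mem_annihilatorIdeal, ← diffOp_eq_derivHom]
  rfl

/-- A squarefree monomial acts on a monomial by lowering exponents. -/
theorem derivHom_prod_X (V : Finset (Vars n)) (s : Vars n →₀ ℕ) :
    derivHom (∏ v ∈ V, X v) (monomial s (1 : F)) =
      monomial (s - ∑ v ∈ V, Finsupp.single v 1) (∏ v ∈ V, (s v : F)) := by
  classical
  induction V using Finset.induction_on with
  | empty => simp
  | insert v V hv ih =>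
    rw [Finset.prod_insert hv, map_mul, Module.End.mul_apply, ih, derivHom_X, pderivEnd_apply,
      pderiv_monomial, Finset.sum_insert hv, Finset.prod_insert hv, add_comm, tsub_add_eq_tsub_tsub,
      mul_comm]
    congr 2
    rw [Finsupp.tsub_apply, Finsupp.finsetSum_apply, Finset.sum_eq_zero, tsub_zero]
    intro w hw
    rw [Finsupp.single_apply, if_neg]
    rintro rfl
    exact hv hw

end Operators

/-! ### Alternants and elementary symmetric operators -/

/-- The variables `x_i` (for `false`) and `y_i` (for `true`). -/
def side {n : ℕ} : Bool → Fin n → Vars n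
  | false => Sum.inl
  | true => Sum.inr

theorem side_injective {n : ℕ} (c : Bool) : Function.Injective (side (n := n) c) := by
  cases c
  · exact Sum.inl_injective
  · exact Sum.inr_injective

section Alternants

variable {F : Type*} [Field F] {n : ℕ}

/-- The exponent of the term of an alternant belonging to a permutation `σ`, where the columns
have the biexponents `(e false j, e true j)`. -/
noncomputable def permExponent (e : Bool → Fin n → ℕ) (σ : Equiv.Perm (Fin n)) : Vars n →₀ ℕ :=
  Finsupp.equivFunOnFinite.symm
    (Sum.elim (fun i => e false (σ.symm i)) (fun i => e true (σ.symm i)))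

theorem permExponent_side (e : Bool → Fin n → ℕ) (σ : Equiv.Perm (Fin n)) (c : Bool) (i : Fin n) :
    permExponent e σ (side c i) = e c (σ.symm i) := by
  cases c <;> rfl

variable (F) in
/-- The alternant `det (x_i^{e_false(j)} y_i^{e_true(j)})`. -/
noncomputable def alternant (e : Bool → Fin n → ℕ) : MvPolynomial (Vars n) F :=
  Matrix.det (Matrix.of fun i j : Fin n =>
    (X (Sum.inl i) ^ e false j * X (Sum.inr i) ^ e true j : MvPolynomial (Vars n) F))

theorem alternant_eq_sum (e : Bool → Fin n → ℕ) :
    alternant F e = ∑ σ : Equiv.Perm (Fin n), (Equiv.Perm.sign σ : ℤ) •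
      monomial (permExponent e σ) (1 : F) := by
  rw [alternant, Matrix.det_apply]
  refine Finset.sum_congr rfl fun σ _ => ?_
  rw [monomial_eq, Finsupp.prod_fintype _ _ (by simp), Fintype.prod_sum_type,
    ← Finset.prod_mul_distrib, ← Equiv.prod_comp σ (fun i => _ * _), Units.smul_def]
  simp [permExponent]

theorem alternant_eq_zero {e : Bool → Fin n → ℕ} {j j' : Fin n} (hj : j ≠ j')
    (h : ∀ c, e c j = e c j') : alternant F e = 0 :=
  Matrix.det_zero_of_column_eq hj fun i => by simp [h]

theorem derivHom_prod_side_alternant (e : Bool → Fin n → ℕ) (c : Bool) (S : Finset (Fin n)) :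
    derivHom (∏ i ∈ S, X (side c i)) (alternant F e) =
      ∑ σ : Equiv.Perm (Fin n), (Equiv.Perm.sign σ : ℤ) •
        monomial (permExponent e σ - ∑ i ∈ S, Finsupp.single (side c i) 1)
          (∏ i ∈ S, (e c (σ.symm i) : F)) := by
  classical
  rw [alternant_eq_sum, map_sum]
  refine Finset.sum_congr rfl fun σ _ => ?_
  rw [map_zsmul]
  have := derivHom_prod_X (F := F) (S.map ⟨side c, side_injective c⟩) (permExponent e σ)
  simp only [Finset.prod_map, Finset.sum_map, Function.Embedding.coeFn_mk,
    permExponent_side] at this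
  rw [this]

/-- Lowering by one the exponents of kind `c` of the columns in `J`. -/
def lowered (e : Bool → Fin n → ℕ) (c : Bool) (J : Finset (Fin n)) : Bool → Fin n → ℕ :=
  fun c' j => if c' = c ∧ j ∈ J then e c' j - 1 else e c' j

/-- Column `j` meets row `σ j` in the term of `σ`. Subtraction is truncated on both sides, so zero
exponents need no exception. -/
theorem permExponent_lowered (e : Bool → Fin n → ℕ) (c : Bool) (J : Finset (Fin n))
    (σ : Equiv.Perm (Fin n)) :
    permExponent (lowered e c J) σ =
      permExponent e σ - ∑ i ∈ J.map σ.toEmbedding, Finsupp.single (side c i) 1 := by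
  classical
  ext v
  rw [Finsupp.tsub_apply, Finsupp.finsetSum_apply]
  obtain ⟨c', i, rfl⟩ : ∃ c' i, side c' i = v := by
    rcases v with i | i
    exacts [⟨false, i, rfl⟩, ⟨true, i, rfl⟩]
  rw [permExponent_side, permExponent_side]
  by_cases hc : c' = c
  · subst hc
    simp only [Finsupp.single_apply, (side_injective c').eq_iff, Finset.sum_ite_eq',
      Finset.mem_map_equiv, lowered, true_and]
    split_ifs <;> simp
  · rw [Finset.sum_eq_zero, tsub_zero, lowered, if_neg (by simp [hc])]
    intro k _
    rw [Finsupp.single_apply, if_neg]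
    cases c <;> cases c' <;> simp_all [side]

/-- In the term of each `σ`, the row sets `S` correspond to the column sets `J` by `S = σ(J)`. Since
all sets of size `k` occur, a symmetric operator on rows becomes an operation on columns. -/
theorem derivHom_esymm_alternant (e : Bool → Fin n → ℕ) (c : Bool) (k : ℕ) :
    derivHom (∑ S ∈ Finset.powersetCard k Finset.univ, ∏ i ∈ S, X (side c i)) (alternant F e) =
      ∑ J ∈ Finset.powersetCard k Finset.univ,
        (∏ j ∈ J, (e c j : F)) • alternant F (lowered e c J) := by
  classical
  rw [map_sum, LinearMap.sum_apply]
  simp only [derivHom_prod_side_alternant]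
  simp only [alternant_eq_sum, Finset.smul_sum]
  rw [Finset.sum_comm]
  conv_rhs => rw [Finset.sum_comm]
  refine Finset.sum_congr rfl fun σ _ => ?_
  symm
  refine Finset.sum_bij (fun J _ => J.map σ.toEmbedding) ?_ ?_ ?_ ?_
  · intro J hJ
    simpa [Finset.mem_powersetCard] using hJ
  · intro J _ J' _ h
    exact Finset.map_injective _ h
  · intro S hS
    refine ⟨S.map σ.symm.toEmbedding, ?_, ?_⟩
    · simpa [Finset.mem_powersetCard] using hS
    · ext; simp
  · intro J _
    rw [permExponent_lowered, smul_comm, smul_monomial, smul_eq_mul, mul_one]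
    simp

end Alternants

/-! ### Three families of relations in the annihilator of `Δ_μ` -/

section Delta

variable (F : Type*) [Field F] (K L : ℕ)

/-- The exponents of `x` (for `false`) and `y` (for `true`) in the columns of `Δ_μ`. -/
def hookExponent (c : Bool) (j : Fin (K + L + 1)) : ℕ :=
  if c then (biexponent K L j).2 else (biexponent K L j).1

theorem hookExponent_false (j : Fin (K + L + 1)) : hookExponent K L false j = j - K := by
  simp only [hookExponent, biexponent]
  split_ifs <;> simp_all

theorem hookExponent_true (j : Fin (K + L + 1)) :
    hookExponent K L true j = if (j : ℕ) ≤ K then (j : ℕ) else 0 := by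
  simp only [hookExponent, biexponent]
  split_ifs <;> simp_all

theorem delta_eq_alternant : delta F K L = alternant F (hookExponent K L) := by
  simp [delta, alternant, hookExponent]

/-- Every cell of the hook has a zero coordinate, so no term of `Δ_μ` contains both `x_i` and `y_i`.
-/
theorem X_mul_X_mem (i : Fin (K + L + 1)) :
    (X (side false i) * X (side true i) : MvPolynomial (Vars (K + L + 1)) F) ∈
      annihilatorIdeal (delta F K L) := by
  classical
  rw [mem_annihilatorIdeal, delta_eq_alternant, alternant_eq_sum, map_sum]
  refine Finset.sum_eq_zero fun σ _ => ?_
  have hne : side false i ≠ side true i := by simp [side]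
  have := derivHom_prod_X (F := F) {side false i, side true i} (permExponent (hookExponent K L) σ)
  rw [Finset.prod_pair hne, Finset.prod_pair hne] at this
  rw [map_zsmul, this, permExponent_side, permExponent_side]
  have h0 : hookExponent K L false (σ.symm i) = 0 ∨ hookExponent K L true (σ.symm i) = 0 := by
    rw [hookExponent_false, hookExponent_true]
    split_ifs <;> omega
  rcases h0 with h | h <;> simp [h]

/-- The largest number of variables of one kind in a term of `Δ_μ`. -/
def sideBound (c : Bool) : ℕ := if c then K else L

theorem card_hookExponent_pos (c : Bool) :
    (Finset.univ.filter fun j => 0 < hookExponent K L c j).card ≤ sideBound K L c := by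
  cases c
  · refine le_trans (Finset.card_le_card_of_injOn (t := Finset.Ioc 0 L)
      (fun j => (j : ℕ) - K) ?_ ?_) (by simp [sideBound])
    · intro j
      have := j.2
      simp only [hookExponent_false, Finset.coe_filter, Finset.mem_univ, true_and,
        Set.mem_ofPred_eq, Finset.coe_Ioc, Set.mem_Ioc]
      omega
    · intro j hj j' hj' h
      simp only [hookExponent_false, Finset.coe_filter, Finset.mem_univ, true_and,
        Set.mem_ofPred_eq] at hj hj' h
      exact Fin.ext (by omega)
  · refine le_trans (Finset.card_le_card_of_injOn (t := Finset.Ioc 0 K)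
      (fun j => (j : ℕ)) ?_ ?_) (by simp [sideBound])
    · intro j
      simp only [hookExponent_true, Finset.coe_filter, Finset.mem_univ, true_and,
        Set.mem_ofPred_eq, Finset.coe_Ioc, Set.mem_Ioc]
      split_ifs <;> omega
    · intro j _ j' _ h
      exact Fin.ext h

/-- At most `sideBound` columns have a positive exponent of kind `c`, so each term of `Δ_μ` misses a
variable indexed by `S`. -/
theorem prod_X_mem (c : Bool) (S : Finset (Fin (K + L + 1))) (hS : sideBound K L c < S.card) :
    (∏ i ∈ S, X (side c i) : MvPolynomial (Vars (K + L + 1)) F) ∈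
      annihilatorIdeal (delta F K L) := by
  rw [mem_annihilatorIdeal, delta_eq_alternant, derivHom_prod_side_alternant]
  refine Finset.sum_eq_zero fun σ _ => ?_
  obtain ⟨i, hi, h⟩ : ∃ i ∈ S, hookExponent K L c (σ.symm i) = 0 := by
    by_contra hc
    push Not at hc
    have h1 : S.map σ.symm.toEmbedding ⊆
        Finset.univ.filter fun j => 0 < hookExponent K L c j := by
      intro j hj
      obtain ⟨i, hi, rfl⟩ := Finset.mem_map.1 hj
      simpa [Nat.pos_iff_ne_zero] using hc i hi
    have h2 := Finset.card_le_card h1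
    rw [Finset.card_map] at h2
    have := card_hookExponent_pos K L c
    omega
  rw [Finset.prod_eq_zero hi (by simp [h])]
  simp

theorem exists_lower_column {c : Bool} {j : Fin (K + L + 1)} (hj : 0 < hookExponent K L c j) :
    ∃ j' < j, hookExponent K L c j' = hookExponent K L c j - 1 ∧
      hookExponent K L (!c) j' = hookExponent K L (!c) j := by
  have hj2 := j.2
  cases c
  · simp only [Bool.not_false, hookExponent_false, hookExponent_true] at hj ⊢
    -- Column `K + 1` is the cell `(1,0)`; lowering it gives `(0,0)`, which is column `0` and not
    -- the preceding one.
    by_cases h1 : (j : ℕ) = K + 1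
    · refine ⟨⟨0, by omega⟩, Fin.lt_def.2 (by simp only; omega), by simp only; omega, ?_⟩
      simp [h1]
    · refine ⟨⟨j - 1, by omega⟩, Fin.lt_def.2 (by simp only; omega), by simp only; omega, ?_⟩
      rw [if_neg (by simp only; omega), if_neg (by omega)]
  · simp only [Bool.not_true, hookExponent_false, hookExponent_true] at hj ⊢
    have hK : (j : ℕ) ≤ K := by
      by_contra h
      simp [h] at hj
    rw [if_pos hK] at hj ⊢
    refine ⟨⟨j - 1, by omega⟩, Fin.lt_def.2 (by simp only; omega), ?_, by simp only; omega⟩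
    rw [if_pos (by simp only; omega)]

/-- If the first column of `J` has a positive exponent, lowering makes it equal to an earlier
column. By minimality that column lies outside `J` and is unchanged, so the alternant has two equal
columns. -/
theorem esymm_mem (c : Bool) {k : ℕ} (hk : 0 < k) :
    (∑ S ∈ Finset.powersetCard k Finset.univ, ∏ i ∈ S, X (side c i) :
      MvPolynomial (Vars (K + L + 1)) F) ∈ annihilatorIdeal (delta F K L) := by
  rw [mem_annihilatorIdeal, delta_eq_alternant, derivHom_esymm_alternant]
  refine Finset.sum_eq_zero fun J hJ => ?_
  have hne : J.Nonempty := Finset.card_pos.1 (by rw [(Finset.mem_powersetCard.1 hJ).2]; exact hk)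
  set j := J.min' hne
  have hjJ : j ∈ J := J.min'_mem hne
  by_cases h0 : hookExponent K L c j = 0
  · rw [Finset.prod_eq_zero hjJ (by simp [h0]), zero_smul]
  obtain ⟨j', hlt, h1, h2⟩ := exists_lower_column K L (Nat.pos_of_ne_zero h0)
  have hj' : j' ∉ J := fun h => absurd (J.min'_le j' h) (not_le.2 hlt)
  rw [alternant_eq_zero hlt.ne, smul_zero]
  intro c'
  by_cases hc : c' = c
  · subst hc
    simp [lowered, hjJ, hj', h1]
  · obtain rfl : c' = !c := by cases c <;> cases c' <;> simp_all
    simp [lowered, h2]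

end Delta

end Hook

namespace Hook

/-! ### Symmetric function identities modulo the relations -/

section SymmetricRelations

variable {Q ι : Type*} [CommRing Q]

open PowerSeries in
theorem coeff_prod_one_sub (ξ : ι → Q) (T : Finset ι) (k : ℕ) :
    coeff k (∏ i ∈ T, (1 - C (ξ i) * X)) =
      (-1) ^ k * ∑ S ∈ Finset.powersetCard k T, ∏ i ∈ S, ξ i := by
  have h1 : ∀ S : Finset ι, ∏ i ∈ S, -(C (ξ i) * X) =
      C ((-1) ^ S.card * ∏ i ∈ S, ξ i) * (X : PowerSeries Q) ^ S.card := by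
    intro S
    rw [Finset.prod_neg, Finset.prod_mul_distrib, Finset.prod_const, map_mul, map_prod, map_pow,
      map_neg, map_one, mul_assoc]
  simp only [sub_eq_add_neg]
  rw [Finset.prod_one_add, map_sum, Finset.mul_sum]
  simp only [h1, coeff_C_mul_X_pow]
  rw [← Finset.sum_filter, Finset.powersetCard_eq_filter]
  refine Finset.sum_congr (Finset.filter_congr fun S _ => eq_comm) fun S hS => ?_
  rw [(Finset.mem_filter.1 hS).2]

theorem mul_eq_zero_of_dvd {x y a b : Q} (h : x * y = 0) (ha : x ∣ a) (hb : y ∣ b) : a * b = 0 :=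
  eq_zero_of_zero_dvd (h ▸ mul_dvd_mul ha hb)

variable [Fintype ι]

theorem dvd_prod_pow {ξ : ι → Q} {c : ι →₀ ℕ} {i : ι} (hi : i ∈ c.support) :
    ξ i ∣ ∏ i, ξ i ^ c i :=
  (dvd_pow_self _ (Finsupp.mem_support_iff.1 hi)).trans
    (Finset.dvd_prod_of_mem (fun i => ξ i ^ c i) (Finset.mem_univ i))

variable [DecidableEq ι]

open PowerSeries in
/-- If the elementary symmetric functions vanish, then the complete homogeneous symmetric functions
on a set are, up to sign, the elementary symmetric functions on its complement. -/
theorem sum_finsuppAntidiag_prod {ξ : ι → Q}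
    (hξ : ∀ k, 0 < k → ∑ S ∈ Finset.powersetCard k Finset.univ, ∏ i ∈ S, ξ i = 0)
    (W : Finset ι) (k : ℕ) :
    ∑ α ∈ W.finsuppAntidiag k, ∏ i, ξ i ^ α i =
      (-1) ^ k * ∑ S ∈ Finset.powersetCard k Wᶜ, ∏ i ∈ S, ξ i := by
  have hone : ∏ i, (1 - C (ξ i) * X) = (1 : PowerSeries Q) := by
    ext j
    rw [coeff_prod_one_sub, coeff_one]
    split_ifs with hj
    · subst hj
      simp
    · rw [hξ j (Nat.pos_of_ne_zero hj), mul_zero]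
  have hinv : ∀ i, (1 - C (ξ i) * X) * PowerSeries.mk (fun j => ξ i ^ j) = 1 := by
    intro i
    ext j
    rw [sub_mul, one_mul, map_sub, mul_assoc, coeff_C_mul, coeff_one]
    cases j with
    | zero => simp
    | succ j => simp [coeff_succ_X_mul, pow_succ']
  have hW : (∏ i ∈ W, (1 - C (ξ i) * X)) * ∏ i ∈ W, PowerSeries.mk (fun j => ξ i ^ j) = 1 := by
    rw [← Finset.prod_mul_distrib, Finset.prod_congr rfl fun i _ => hinv i, Finset.prod_const_one]
  have hWc : (∏ i ∈ W, (1 - C (ξ i) * X)) * ∏ i ∈ Wᶜ, (1 - C (ξ i) * X) = 1 := by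
    rw [Finset.prod_mul_prod_compl, hone]
  -- Both sides invert the product over `W`: the left one by geometric series, the right one because
  -- the product over all indices is `1`.
  have hH : ∏ i ∈ W, PowerSeries.mk (fun j => ξ i ^ j) = ∏ i ∈ Wᶜ, (1 - C (ξ i) * X) :=
    left_inv_eq_right_inv (by rw [mul_comm]; exact hW) hWc
  rw [← coeff_prod_one_sub, ← hH, coeff_prod]
  refine Finset.sum_congr rfl fun α hα => ?_
  rw [← Finset.prod_subset (Finset.subset_univ W)]
  · exact Finset.prod_congr rfl fun i _ => (coeff_mk _ _).symm
  · intro i _ hi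
    have : i ∉ α.support := fun h => hi ((Finset.mem_finsuppAntidiag.1 hα).2 h)
    rw [Finsupp.notMem_support_iff.1 this, pow_zero]

/-- Each `h` becomes an `e` on the complement, giving index sets `S` and `T` of sizes `k` and `l`. A
surviving term needs `S` and `T` disjoint, `S` off `d.support` and `T` off `c.support`, so `S ∪ T`
avoids the intersection in `h`; there is no room for it. -/
theorem prod_pow_mul_complete_mul_complete {ξ η : ι → Q}
    (hξ : ∀ k, 0 < k → ∑ S ∈ Finset.powersetCard k Finset.univ, ∏ i ∈ S, ξ i = 0)
    (hη : ∀ k, 0 < k → ∑ S ∈ Finset.powersetCard k Finset.univ, ∏ i ∈ S, η i = 0)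
    (hξη : ∀ i, ξ i * η i = 0) {c d : ι →₀ ℕ} {W Z : Finset ι} {k l : ℕ}
    (h : Fintype.card ι < k + l + ((W ∪ d.support) ∩ (Z ∪ c.support)).card) :
    ((∏ i, ξ i ^ c i) * ∑ α ∈ W.finsuppAntidiag k, ∏ i, ξ i ^ α i) *
      ((∏ i, η i ^ d i) * ∑ β ∈ Z.finsuppAntidiag l, ∏ i, η i ^ β i) = 0 := by
  rw [sum_finsuppAntidiag_prod hξ, sum_finsuppAntidiag_prod hη]
  simp only [Finset.mul_sum, Finset.sum_mul]
  refine Finset.sum_eq_zero fun T hT => Finset.sum_eq_zero fun S hS => ?_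
  rw [Finset.mem_powersetCard] at hS hT
  have key : ∃ i, (i ∈ S ∨ i ∈ c.support) ∧ (i ∈ T ∨ i ∈ d.support) ∧ (i ∈ S ∨ i ∈ T) := by
    by_contra hc
    push Not at hc
    have h1 : S ∪ T ⊆ ((W ∪ d.support) ∩ (Z ∪ c.support))ᶜ := by
      intro i hi
      have h2 := hc i
      have h3 := @hS.1 i
      have h4 := @hT.1 i
      simp only [Finset.mem_union, Finset.mem_compl, Finset.mem_inter] at *
      tauto
    have h2 : Disjoint S T := by
      rw [Finset.disjoint_left]
      intro i h3 h4
      exact (hc i (Or.inl h3) (Or.inl h4)).1 h3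
    have h3 := Finset.card_le_card h1
    rw [Finset.card_union_of_disjoint h2, Finset.card_compl, hS.2, hT.2] at h3
    have h4 := Finset.card_le_univ ((W ∪ d.support) ∩ (Z ∪ c.support))
    omega
  obtain ⟨i, h1, h2, _⟩ := key
  refine mul_eq_zero_of_dvd (hξη i) ?_ ?_
  · rcases h1 with h1 | h1
    · exact ((Finset.dvd_prod_of_mem _ h1).mul_left _).mul_left _
    · exact (dvd_prod_pow h1).mul_right _
  · rcases h2 with h2 | h2
    · exact ((Finset.dvd_prod_of_mem _ h2).mul_left _).mul_left _
    · exact (dvd_prod_pow h2).mul_right _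

/-- After passing to `e_k` on the complement of `A`, each term contains the product over `A` (from
`c`) and over a disjoint set of size `k`, hence over more than `N` indices. -/
theorem prod_pow_mul_complete {ξ : ι → Q} {N : ℕ}
    (hξ : ∀ k, 0 < k → ∑ S ∈ Finset.powersetCard k Finset.univ, ∏ i ∈ S, ξ i = 0)
    (hN : ∀ S : Finset ι, N < S.card → ∏ i ∈ S, ξ i = 0) {c : ι →₀ ℕ} {A : Finset ι} {k : ℕ}
    (hA : A ⊆ c.support) (h : N < A.card + k) :
    (∏ i, ξ i ^ c i) * ∑ α ∈ A.finsuppAntidiag k, ∏ i, ξ i ^ α i = 0 := by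
  rw [sum_finsuppAntidiag_prod hξ]
  simp only [Finset.mul_sum]
  refine Finset.sum_eq_zero fun S hS => ?_
  rw [Finset.mem_powersetCard] at hS
  have hd : Disjoint A S := Finset.disjoint_left.2 fun i h1 h2 => by
    have := hS.1 h2
    simp [h1] at this
  have h0 := hN (A ∪ S) (by rw [Finset.card_union_of_disjoint hd, hS.2]; exact h)
  rw [Finset.prod_union hd] at h0
  refine mul_eq_zero_of_dvd h0 ?_ (Dvd.intro_left _ rfl)
  refine (Finset.prod_dvd_prod_of_dvd _ _ fun i hi => ?_).trans
    (Finset.prod_dvd_prod_of_subset A _ _ (Finset.subset_univ A))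
  exact dvd_pow_self _ (Finsupp.mem_support_iff.1 (hA hi))

end SymmetricRelations

/-! ### Leading monomials -/

section LeadingMonomials

open MvPolynomial

variable {F : Type*} [Field F] {n : ℕ}

theorem LexLT.ne {a b : Vars n →₀ ℕ} (h : LexLT a b) : a ≠ b := by
  rintro rfl
  rcases h with ⟨i, h, _⟩ | ⟨_, i, h, _⟩ <;> exact lt_irrefl _ h

/-- The monomial `m` is the leading monomial of an element of `I`. -/
def IsReducible (I : Ideal (MvPolynomial (Vars n) F)) (m : Vars n →₀ ℕ) : Prop :=
  ∃ P ∈ I, IsLexLeading P m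

theorem isReducible_of_mem {I : Ideal (MvPolynomial (Vars n) F)} {m : Vars n →₀ ℕ}
    (h : monomial m 1 ∈ I) : IsReducible I m := by
  refine ⟨_, h, ?_, ?_⟩ <;> simp +contextual

/-- Terms lying in `I` can be dropped from the sum. In what remains, `f j₀` strictly exceeds all
other terms and so keeps coefficient `1`. -/
theorem isReducible_of_sum_mem {I : Ideal (MvPolynomial (Vars n) F)} {J : Type*} {s : Finset J}
    {f : J → Vars n →₀ ℕ} {j₀ : J} (hj₀ : j₀ ∈ s) (hs : ∑ j ∈ s, monomial (f j) 1 ∈ I)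
    (h : ∀ j ∈ s, j ≠ j₀ → monomial (f j) 1 ∈ I ∨ LexLT (f j) (f j₀)) :
    IsReducible I (f j₀) := by
  classical
  by_cases h0 : monomial (f j₀) 1 ∈ I
  · exact isReducible_of_mem h0
  set t := s.filter fun j => (monomial (f j) 1 : MvPolynomial (Vars n) F) ∉ I
  have ht : ∀ j ∈ t, j ≠ j₀ → LexLT (f j) (f j₀) := by
    intro j hj hne
    rw [Finset.mem_filter] at hj
    exact (h j hj.1 hne).resolve_left hj.2
  refine ⟨∑ j ∈ t, monomial (f j) 1, ?_, ?_, ?_⟩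
  · rw [← Finset.sum_filter_add_sum_filter_not s
      fun j => (monomial (f j) 1 : MvPolynomial (Vars n) F) ∉ I] at hs
    refine (Ideal.add_mem_iff_left _ (Ideal.sum_mem _ fun j hj => ?_)).1 hs
    simpa using (Finset.mem_filter.1 hj).2
  · rw [mem_support_iff, coeff_sum, Finset.sum_eq_single j₀]
    · simp
    · intro j hj hne
      rw [coeff_monomial, if_neg (ht j hj hne).ne]
    · intro hn
      exact absurd (Finset.mem_filter.2 ⟨hj₀, h0⟩) hn
  · intro m' hm' hne
    obtain ⟨j, hj, hm⟩ := Finset.mem_biUnion.1 (support_sum hm')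
    have hm : m' = f j := by
      have := support_monomial_subset hm
      simpa using this
    subst hm
    exact ht j hj fun hjj => hne (by rw [hjj])

theorem lexLT_sumElim {α β α' β' : Fin n →₀ ℕ} :
    LexLT (Finsupp.sumElim α β) (Finsupp.sumElim α' β') ↔
      (∃ i, α i < α' i ∧ ∀ j, i < j → α j = α' j) ∨
        ((∀ j, α j = α' j) ∧ ∃ i, β i < β' i ∧ ∀ j, i < j → β j = β' j) :=
  Iff.rfl

/-- Among monomials of degree `k` in variables up to place `w`, the power of the variable at `w` is
lexicographically largest. -/
theorem eq_single_or_lt {W : Finset (Fin n)} {k : ℕ} {w : Fin n} {α : Fin n →₀ ℕ}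
    (hα : α ∈ W.finsuppAntidiag k) (hw : ∀ i, α i ≠ 0 → i ≤ w) :
    α = Finsupp.single w k ∨ α w < k ∧ ∀ j, w < j → α j = 0 := by
  have hsum : ∑ i, α i = k := by
    rw [← (Finset.mem_finsuppAntidiag.1 hα).1]
    refine (Finset.sum_subset (Finset.subset_univ W) fun i _ hi => ?_).symm
    by_contra h
    exact hi ((Finset.mem_finsuppAntidiag.1 hα).2 (Finsupp.mem_support_iff.2 h))
  rw [← Finset.add_sum_erase _ _ (Finset.mem_univ w)] at hsum
  have hgt : ∀ j, w < j → α j = 0 := fun j hj => by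
    by_contra h
    exact absurd (hw j h) (not_le.2 hj)
  rcases (show α w ≤ k by omega).lt_or_eq with h | h
  · exact Or.inr ⟨h, hgt⟩
  · left
    have h0 : ∑ i ∈ Finset.univ.erase w, α i = 0 := by omega
    rw [Finset.sum_eq_zero_iff] at h0
    ext j
    by_cases hj : j = w
    · subst hj
      simp [h]
    · rw [Finsupp.single_apply, if_neg (Ne.symm hj)]
      exact h0 j (by simp [hj])

theorem single_mem_finsuppAntidiag {W : Finset (Fin n)} {k : ℕ} {w : Fin n} (h : k = 0 ∨ w ∈ W) :
    Finsupp.single w k ∈ W.finsuppAntidiag k := by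
  rcases h with rfl | h
  · simp
  · rw [Finset.mem_finsuppAntidiag]
    refine ⟨?_, Finsupp.support_single_subset.trans (by simpa using h)⟩
    rw [Finset.sum_eq_single_of_mem w h fun i _ hi => by simp [hi.symm]]
    simp

theorem monomial_sumElim (α β : Fin n →₀ ℕ) :
    (monomial (Finsupp.sumElim α β) 1 : MvPolynomial (Vars n) F) =
      (∏ i, X (side false i) ^ α i) * ∏ i, X (side true i) ^ β i := by
  rw [monomial_eq, Finsupp.prod_fintype _ _ (by simp), Fintype.prod_sum_type]
  simp [side]

end LeadingMonomials

/-! ### Families of reducible monomials -/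

section Reduction

open MvPolynomial

variable (F : Type*) [Field F] (K L : ℕ)

/-- The variables modulo the annihilator of `Δ_μ`. -/
noncomputable def residue (c : Bool) (i : Fin (K + L + 1)) :
    MvPolynomial (Vars (K + L + 1)) F ⧸ annihilatorIdeal (delta F K L) :=
  Ideal.Quotient.mk _ (X (side c i))

theorem residue_esymm (c : Bool) (k : ℕ) (hk : 0 < k) :
    ∑ S ∈ Finset.powersetCard k Finset.univ, ∏ i ∈ S, residue F K L c i = 0 := by
  have := Ideal.Quotient.eq_zero_iff_mem.2 (esymm_mem F K L c hk)
  rw [map_sum] at this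
  simp only [map_prod] at this
  exact this

theorem residue_mul (i : Fin (K + L + 1)) :
    residue F K L false i * residue F K L true i = 0 := by
  have := Ideal.Quotient.eq_zero_iff_mem.2 (X_mul_X_mem F K L i)
  rwa [map_mul] at this

theorem residue_prod (c : Bool) (S : Finset (Fin (K + L + 1))) (hS : sideBound K L c < S.card) :
    ∏ i ∈ S, residue F K L c i = 0 := by
  have := Ideal.Quotient.eq_zero_iff_mem.2 (prod_X_mem F K L c S hS)
  rwa [map_prod] at this

variable {K L}

theorem mk_monomial_sumElim (α β : Fin (K + L + 1) →₀ ℕ) :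
    Ideal.Quotient.mk (annihilatorIdeal (delta F K L)) (monomial (Finsupp.sumElim α β) 1) =
      (∏ i, residue F K L false i ^ α i) * ∏ i, residue F K L true i ^ β i := by
  rw [monomial_sumElim, map_mul, map_prod, map_prod]
  simp only [map_pow]
  rfl

theorem monomial_mem_of_clash {α β : Fin (K + L + 1) →₀ ℕ} {i : Fin (K + L + 1)} (hα : α i ≠ 0)
    (hβ : β i ≠ 0) : monomial (Finsupp.sumElim α β) 1 ∈ annihilatorIdeal (delta F K L) := by
  rw [← Ideal.Quotient.eq_zero_iff_mem, mk_monomial_sumElim]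
  exact mul_eq_zero_of_dvd (residue_mul F K L i) (dvd_prod_pow (Finsupp.mem_support_iff.2 hα))
    (dvd_prod_pow (Finsupp.mem_support_iff.2 hβ))

theorem sum_monomial_mem {c d : Fin (K + L + 1) →₀ ℕ} {s t : Finset (Fin (K + L + 1) →₀ ℕ)}
    (h : ((∏ i, residue F K L false i ^ c i) * ∑ α ∈ s, ∏ i, residue F K L false i ^ α i) *
      ((∏ i, residue F K L true i ^ d i) * ∑ β ∈ t, ∏ i, residue F K L true i ^ β i) = 0) :
    ∑ p ∈ s ×ˢ t, monomial (Finsupp.sumElim (c + p.1) (d + p.2)) 1 ∈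
      annihilatorIdeal (delta F K L) := by
  rw [← Ideal.Quotient.eq_zero_iff_mem, map_sum, ← h, Finset.mul_sum, Finset.mul_sum,
    Finset.sum_mul_sum, Finset.sum_product]
  refine Finset.sum_congr rfl fun α _ => Finset.sum_congr rfl fun β _ => ?_
  rw [mk_monomial_sumElim]
  simp only [Finsupp.add_apply, pow_add, Finset.prod_mul_distrib]

/-- The relation used is `x^c h_{a w}(x) y^d h_{b q}(y)`, over the sets `insert w W` and `insert q
Z`, where `c` and `d` are `a` and `b` stripped of their exponents at `w` and `q`. A place of `W`
beyond `w` produces a clash `x_i y_i` with `d`, whence `i ≠ q` in `hW`. The `x`-part is compared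
first, so when the `y`-part matters the `x`-part is already all of `a`, and `hZ` needs no such
exclusion. If `a w = 0`, then `h_0 = 1` and `W` is unrestricted; likewise for `b q` and `Z`. -/
theorem isReducible_of_card_lt {a b : Fin (K + L + 1) →₀ ℕ} (w q : Fin (K + L + 1))
    {W Z : Finset (Fin (K + L + 1))}
    (hW : a w = 0 ∨ ∀ i ∈ W, i ≤ w ∨ i ≠ q ∧ b i ≠ 0)
    (hZ : b q = 0 ∨ ∀ i ∈ Z, i ≤ q ∨ a i ≠ 0)
    (h : K + L + 1 < a w + b q + (W ∩ Z).card) :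
    IsReducible (annihilatorIdeal (delta F K L)) (Finsupp.sumElim a b) := by
  classical
  set c := a - Finsupp.single w (a w)
  set d := b - Finsupp.single q (b q)
  have hca : ∀ i, i ≠ w → c i = a i := fun i hi => by simp [c, hi.symm]
  have hdb : ∀ i, i ≠ q → d i = b i := fun i hi => by simp [d, hi.symm]
  have hcw : c w = 0 := by simp [c]
  have hdq : d q = 0 := by simp [d]
  have hc : c + Finsupp.single w (a w) = a := tsub_add_cancel_of_le (by simp)
  have hd : d + Finsupp.single q (b q) = b := tsub_add_cancel_of_le (by simp)
  have hs := sum_monomial_mem F (prod_pow_mul_complete_mul_complete (residue_esymm F K L false)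
    (residue_esymm F K L true) (residue_mul F K L) (c := c) (d := d) (W := insert w W)
    (Z := insert q Z) (k := a w) (l := b q) (by
      rw [Fintype.card_fin]
      refine h.trans_le (Nat.add_le_add_left (Finset.card_le_card ?_) _)
      intro i
      simp only [Finset.mem_inter, Finset.mem_union, Finset.mem_insert]
      tauto))
  have := isReducible_of_sum_mem (f := fun p : (Fin (K + L + 1) →₀ ℕ) × _ =>
    Finsupp.sumElim (c + p.1) (d + p.2)) (j₀ := (Finsupp.single w (a w), Finsupp.single q (b q)))
    (by
      rw [Finset.mem_product]
      exact ⟨single_mem_finsuppAntidiag (by simp), single_mem_finsuppAntidiag (by simp)⟩) hs ?_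
  · simpa only [hc, hd] using this
  rintro ⟨α, β⟩ hp hne
  rw [Finset.mem_product] at hp
  obtain ⟨hα, hβ⟩ := hp
  simp only at hα hβ ⊢
  refine or_iff_not_imp_left.2 fun hclash => ?_
  have hcl : ∀ i, (c + α) i = 0 ∨ (d + β) i = 0 := fun i => by
    by_contra hi
    push Not at hi
    exact hclash (monomial_mem_of_clash F hi.1 hi.2)
  simp only [Finsupp.add_apply] at hcl
  have hsα : ∀ i, α i ≠ 0 → i ≤ w := by
    intro i hi
    rcases hW with h0 | hW
    · rw [h0] at hα
      simp only [Finset.finsuppAntidiag_zero, Finset.mem_singleton] at hα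
      simp [hα] at hi
    · rcases Finset.mem_insert.1 ((Finset.mem_finsuppAntidiag.1 hα).2
        (Finsupp.mem_support_iff.2 hi)) with rfl | hiW
      · exact le_rfl
      · refine (hW i hiW).resolve_right fun h1 => ?_
        have := hcl i
        rw [hdb i h1.1] at this
        omega
  rw [lexLT_sumElim]
  rcases eq_single_or_lt hα hsα with hα' | ⟨hlt, hgt⟩
  · subst hα'
    have hsβ : ∀ i, β i ≠ 0 → i ≤ q := by
      intro i hi
      rcases hZ with h0 | hZ
      · rw [h0] at hβ
        simp only [Finset.finsuppAntidiag_zero, Finset.mem_singleton] at hβ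
        simp [hβ] at hi
      · rcases Finset.mem_insert.1 ((Finset.mem_finsuppAntidiag.1 hβ).2
          (Finsupp.mem_support_iff.2 hi)) with rfl | hiZ
        · exact le_rfl
        · refine (hZ i hiZ).resolve_right fun h1 => ?_
          have h2 := hcl i
          have h3 := DFunLike.congr_fun hc i
          rw [Finsupp.add_apply] at h3
          omega
    rcases eq_single_or_lt hβ hsβ with hβ' | ⟨hlt, hgt⟩
    · exact absurd (by rw [hβ']) hne
    · refine Or.inr ⟨fun _ => rfl, q, ?_, fun j hj => ?_⟩
      · simpa using hlt
      · simp [hgt j hj, hj.ne]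
  · refine Or.inl ⟨w, ?_, fun j hj => ?_⟩
    · simpa using hlt
    · simp [hgt j hj, hj.ne]

/-- The number of `i < w` in the support of `a`. -/
def supportBelow {n : ℕ} (a : Fin n →₀ ℕ) (w : Fin n) : ℕ :=
  (Finset.univ.filter fun i => i < w ∧ 0 < a i).card

/-- One factor at `w` is left in `c`, so that `w` itself belongs to `A ⊆ c.support`; then `k = a w -
1` and `A` has `supportBelow a w + 1` elements. -/
theorem exists_completeData {n N : ℕ} {a : Fin n →₀ ℕ} {w : Fin n} (hw : 0 < a w)
    (h : N < a w + supportBelow a w) :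
    ∃ (c : Fin n →₀ ℕ) (A : Finset (Fin n)) (k : ℕ), A ⊆ c.support ∧ N < A.card + k ∧
      (∀ i ∈ A, i ≤ w) ∧ w ∈ A ∧ c + Finsupp.single w k = a := by
  classical
  have hc : a - Finsupp.single w (a w - 1) + Finsupp.single w (a w - 1) = a :=
    tsub_add_cancel_of_le (by simp)
  refine ⟨a - Finsupp.single w (a w - 1),
    insert w (Finset.univ.filter fun i => i < w ∧ 0 < a i), a w - 1, ?_, ?_, ?_, by simp, hc⟩
  · intro i hi
    rw [Finsupp.mem_support_iff, Finsupp.tsub_apply, Finsupp.single_apply]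
    rcases Finset.mem_insert.1 hi with rfl | hi
    · rw [if_pos rfl]
      omega
    · simp only [Finset.mem_filter, Finset.mem_univ, true_and] at hi
      rw [if_neg hi.1.ne']
      omega
  · rw [Finset.card_insert_of_notMem (by simp)]
    unfold supportBelow at h
    omega
  · intro i hi
    rcases Finset.mem_insert.1 hi with rfl | hi
    · exact le_rfl
    · simp only [Finset.mem_filter, Finset.mem_univ, true_and] at hi
      exact hi.1.le

theorem isReducible_of_left {a b : Fin (K + L + 1) →₀ ℕ} {w : Fin (K + L + 1)} (hw : 0 < a w)
    (h : L < a w + supportBelow a w) :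
    IsReducible (annihilatorIdeal (delta F K L)) (Finsupp.sumElim a b) := by
  classical
  obtain ⟨c, A, k, hA, hk, hle, hwA, rfl⟩ := exists_completeData hw h
  have hs := sum_monomial_mem F (c := c) (d := b) (s := A.finsuppAntidiag k) (t := {0}) (by
    rw [prod_pow_mul_complete (residue_esymm F K L false) (residue_prod F K L false) hA hk,
      zero_mul])
  have := isReducible_of_sum_mem (f := fun p : (Fin (K + L + 1) →₀ ℕ) × _ =>
    Finsupp.sumElim (c + p.1) (b + p.2)) (j₀ := (Finsupp.single w k, 0))
    (by simpa using single_mem_finsuppAntidiag (W := A) (k := k) (Or.inr hwA)) hs ?_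
  · simpa using this
  rintro ⟨α, β⟩ hp hne
  simp only [Finset.mem_product, Finset.mem_singleton] at hp
  obtain ⟨hα, rfl⟩ := hp
  right
  rw [lexLT_sumElim]
  rcases eq_single_or_lt hα fun i hi => hle i ((Finset.mem_finsuppAntidiag.1 hα).2
    (Finsupp.mem_support_iff.2 hi)) with rfl | ⟨hlt, hgt⟩
  · exact absurd rfl hne
  · refine Or.inl ⟨w, ?_, fun j hj => ?_⟩
    · simpa using hlt
    · simp [hgt j hj, hj.ne]

theorem isReducible_of_right {a b : Fin (K + L + 1) →₀ ℕ} {w : Fin (K + L + 1)} (hw : 0 < b w)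
    (h : K < b w + supportBelow b w) :
    IsReducible (annihilatorIdeal (delta F K L)) (Finsupp.sumElim a b) := by
  classical
  obtain ⟨c, A, k, hA, hk, hle, hwA, rfl⟩ := exists_completeData hw h
  have hs := sum_monomial_mem F (c := a) (d := c) (s := {0}) (t := A.finsuppAntidiag k) (by
    rw [prod_pow_mul_complete (residue_esymm F K L true) (residue_prod F K L true) hA hk,
      mul_zero])
  have := isReducible_of_sum_mem (f := fun p : (Fin (K + L + 1) →₀ ℕ) × _ =>
    Finsupp.sumElim (a + p.1) (c + p.2)) (j₀ := (0, Finsupp.single w k))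
    (by simpa using single_mem_finsuppAntidiag (W := A) (k := k) (Or.inr hwA)) hs ?_
  · simpa using this
  rintro ⟨α, β⟩ hp hne
  simp only [Finset.mem_product, Finset.mem_singleton] at hp
  obtain ⟨rfl, hβ⟩ := hp
  right
  rw [lexLT_sumElim]
  rcases eq_single_or_lt hβ fun i hi => hle i ((Finset.mem_finsuppAntidiag.1 hβ).2
    (Finsupp.mem_support_iff.2 hi)) with rfl | ⟨hlt, hgt⟩
  · exact absurd rfl hne
  · refine Or.inr ⟨fun _ => rfl, w, ?_, fun j hj => ?_⟩
    · simpa using hlt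
    · simp [hgt j hj, hj.ne]

end Reduction

/-! ### Irreducible monomials come from dessins -/

open MvPolynomial

theorem add_supportCount_le_card {n p r : ℕ} {a : ℕ → ℕ} {U : Finset (Fin n)} (hp : p ≤ n)
    (hr : r ≤ n) (h : ∀ i : Fin n, (i : ℕ) < p ∨ (i : ℕ) < r ∧ 0 < a i → i ∈ U) :
    p + supportCount a p r ≤ U.card := by
  have h1 : Finset.range p ∪ (Finset.Ico p r).filter (fun i => 0 < a i) ⊆
      U.map Fin.valEmbedding := by
    intro t ht
    simp only [Finset.mem_union, Finset.mem_range, Finset.mem_filter, Finset.mem_Ico] at ht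
    exact Finset.mem_map.2 ⟨⟨t, by omega⟩, h _ (by simp only; omega), rfl⟩
  have h2 := Finset.card_le_card h1
  rw [Finset.card_map, Finset.card_union_of_disjoint, Finset.card_range] at h2
  · exact h2
  · rw [Finset.disjoint_left]
    intro t ht
    simp only [Finset.mem_range, Finset.mem_filter, Finset.mem_Ico] at ht ⊢
    omega

/-- Extension by zero of an exponent vector to all natural numbers. -/
def extendZero {n : ℕ} (a : Fin n →₀ ℕ) (i : ℕ) : ℕ := if h : i < n then a ⟨i, h⟩ else 0

theorem extendZero_val {n : ℕ} (a : Fin n →₀ ℕ) (i : Fin n) : extendZero a i = a i := by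
  simp [extendZero]

theorem supportCount_extendZero_le {n : ℕ} (a : Fin n →₀ ℕ) (w : Fin n) :
    supportCount (extendZero a) 0 w ≤ supportBelow a w := by
  have := add_supportCount_le_card (p := 0) (r := w) (a := extendZero a)
    (U := Finset.univ.filter fun i => i < w ∧ 0 < a i) (Nat.zero_le _) w.2.le (by
      intro i hi
      simpa [extendZero_val] using hi)
  simpa [supportBelow] using this

/-- An empty place inherits the bound from the last occupied place before it. -/
theorem add_supportCount_le {n N : ℕ} {a : Fin n →₀ ℕ}
    (h : ∀ w, 0 < a w → a w + supportBelow a w ≤ N) {w : ℕ} (hw : w < n) :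
    extendZero a w + supportCount (extendZero a) 0 w ≤ N := by
  have hpos : ∀ w, w < n → 0 < extendZero a w →
      extendZero a w + supportCount (extendZero a) 0 w ≤ N := by
    intro w hw h0
    have h1 := h ⟨w, hw⟩
    have h2 := supportCount_extendZero_le a ⟨w, hw⟩
    have h3 := extendZero_val a ⟨w, hw⟩
    simp only at h2 h3
    omega
  have hcount : ∀ w, w ≤ n → supportCount (extendZero a) 0 w ≤ N := by
    intro w
    induction w with
    | zero => intro _; simp [supportCount]
    | succ w ih =>
      intro hw
      rw [← supportCount_add _ (Nat.zero_le w) (Nat.le_succ w),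
        supportCount_succ_left _ (Nat.lt_succ_self w), supportCount_self]
      split_ifs with h0
      · have := hpos w (by omega) h0
        omega
      · exact ih (by omega)
  rcases Nat.eq_zero_or_pos (extendZero a w) with h0 | h0
  · rw [h0, zero_add]
    exact hcount w hw.le
  · exact hpos w hw h0

theorem Dessin.exponent_eq {K L : ℕ} {a b : Fin (K + L + 1) →₀ ℕ} {D : Dessin K L}
    (ha : a (Fin.last _) = 0) (hb : b (Fin.last _) = 0)
    (hY : ∀ i, i ∈ D.Y → a i.castSucc = 0 ∧ D.c i = b i.castSucc)
    (hX : ∀ i, i ∉ D.Y → b i.castSucc = 0 ∧ D.c i = a i.castSucc) :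
    D.exponent = Finsupp.sumElim a b := by
  classical
  have hl : ∀ j : Fin (K + L), j.castSucc ≠ Fin.last _ := fun j => (Fin.castSucc_lt_last j).ne
  ext v
  rw [Dessin.exponent, Finsupp.finsetSum_apply]
  rcases v with j | j <;> induction j using Fin.lastCases with
  | last =>
    simp only [Finsupp.sumElim_inl, Finsupp.sumElim_inr, ha, hb]
    refine Finset.sum_eq_zero fun i _ => ?_
    split_ifs <;> simp [hl]
  | cast j =>
    simp only [Finsupp.sumElim_inl, Finsupp.sumElim_inr]
    rw [Finset.sum_eq_single j]
    · by_cases hj : j ∈ D.Y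
      · simp [hj, hY j hj]
      · simp [hj, hX j hj]
    · intro i _ hi
      split_ifs <;> simp [hi]
    · simp

section Reduction

variable (F : Type*) [Field F] {K L : ℕ}

theorem exists_dessin_of_not_isReducible {a b : Fin (K + L + 1) →₀ ℕ}
    (hred : ¬ IsReducible (annihilatorIdeal (delta F K L)) (Finsupp.sumElim a b)) :
    ∃ D : Dessin K L, D.exponent = Finsupp.sumElim a b := by
  classical
  set a' := extendZero a
  set b' := extendZero b
  have hav : ∀ i : Fin (K + L + 1), a' i = a i := extendZero_val a
  have hbv : ∀ i : Fin (K + L + 1), b' i = b i := extendZero_val b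
  have hab : ∀ i, a' i = 0 ∨ b' i = 0 := by
    intro i
    by_cases hi : i < K + L + 1
    · by_contra hc
      push Not at hc
      have h1 := hav ⟨i, hi⟩
      have h2 := hbv ⟨i, hi⟩
      simp only at h1 h2
      exact hred (isReducible_of_mem (monomial_mem_of_clash F (i := ⟨i, hi⟩) (by omega) (by omega)))
    · simp [a', extendZero, hi]
  -- The case `q = w`: since `b w = 0`, the set `Z` may be everything.
  have hX : ∀ w, w < K + L + 1 → 0 < a' w →
      a' w + (w + 1 + supportCount b' (w + 1) (K + L + 1)) ≤ K + L + 1 := by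
    intro w hw h0
    by_contra hc
    have hw' := hav ⟨w, hw⟩
    have hb0 := hbv ⟨w, hw⟩
    have h1 := hab w
    simp only at hw' hb0
    refine hred (isReducible_of_card_lt F ⟨w, hw⟩ ⟨w, hw⟩
      (W := Finset.univ.filter fun i => i ≤ ⟨w, hw⟩ ∨ 0 < b i) (Z := Finset.univ)
      (Or.inr ?_) (Or.inl (by omega)) ?_)
    · intro i hi
      rw [Finset.mem_filter] at hi
      refine hi.2.imp_right fun h2 => ⟨?_, h2.ne'⟩
      rintro rfl
      omega
    · rw [Finset.inter_univ]
      have := add_supportCount_le_card (a := b') (p := w + 1) (r := K + L + 1)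
        (U := Finset.univ.filter fun i => i ≤ ⟨w, hw⟩ ∨ 0 < b i) hw le_rfl (by
          intro i hi
          simp only [Finset.mem_filter, Finset.mem_univ, true_and, Fin.le_def, ← hbv]
          omega)
      omega
  have hY : ∀ q, q < K + L + 1 → 0 < b' q →
      b' q + (q + 1 + supportCount a' (q + 1) (K + L + 1)) ≤ K + L + 1 := by
    intro q hq h0
    by_contra hc
    have hq' := hbv ⟨q, hq⟩
    have ha0 := hav ⟨q, hq⟩
    have h1 := hab q
    simp only at hq' ha0
    refine hred (isReducible_of_card_lt F ⟨q, hq⟩ ⟨q, hq⟩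
      (W := Finset.univ) (Z := Finset.univ.filter fun i => i ≤ ⟨q, hq⟩ ∨ 0 < a i)
      (Or.inl (by omega)) (Or.inr ?_) ?_)
    · intro i hi
      rw [Finset.mem_filter] at hi
      exact hi.2.imp_right fun h2 => h2.ne'
    · rw [Finset.univ_inter]
      have := add_supportCount_le_card (a := a') (p := q + 1) (r := K + L + 1)
        (U := Finset.univ.filter fun i => i ≤ ⟨q, hq⟩ ∨ 0 < a i) hq le_rfl (by
          intro i hi
          simp only [Finset.mem_filter, Finset.mem_univ, true_and, Fin.le_def, ← hav]
          omega)
      omega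
  -- The count includes `w` itself; this extra unit yields the strict inequality demanded by
  -- `exists_dessin`.
  have hXY : ∀ q w, q < w → w < K + L + 1 → 0 < b' q → 0 < a' w →
      b' q + a' w + (q + 1 + supportCount a' (q + 1) (w + 1)) ≤ K + L + 1 := by
    intro q w hqw hw h0 h0'
    by_contra hc
    have hq : q < K + L + 1 := by omega
    have hw' := hav ⟨w, hw⟩
    have hq' := hbv ⟨q, hq⟩
    simp only at hw' hq'
    refine hred (isReducible_of_card_lt F ⟨w, hw⟩ ⟨q, hq⟩
      (W := Finset.univ.filter fun i => i ≤ ⟨w, hw⟩)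
      (Z := Finset.univ.filter fun i => i ≤ ⟨q, hq⟩ ∨ 0 < a i) (Or.inr ?_) (Or.inr ?_) ?_)
    · intro i hi
      rw [Finset.mem_filter] at hi
      exact Or.inl hi.2
    · intro i hi
      rw [Finset.mem_filter] at hi
      exact hi.2.imp_right fun h2 => h2.ne'
    · rw [← Finset.filter_and]
      have := add_supportCount_le_card (a := a') (p := q + 1) (r := w + 1)
        (U := Finset.univ.filter fun i => i ≤ ⟨w, hw⟩ ∧ (i ≤ ⟨q, hq⟩ ∨ 0 < a i)) hq hw (by
          intro i hi
          simp only [Finset.mem_filter, Finset.mem_univ, true_and, Fin.le_def, ← hav]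
          omega)
      omega
  -- Here `q` is not counted: its exponent is absent from `d` and cannot exclude a term by a clash.
  have hYX : ∀ w q, w < q → q < K + L + 1 → 0 < a' w → 0 < b' q →
      a' w + b' q + (w + 1 + supportCount b' (w + 1) q) ≤ K + L + 1 := by
    intro w q hwq hq h0 h0'
    by_contra hc
    have hw : w < K + L + 1 := by omega
    have hw' := hav ⟨w, hw⟩
    have hq' := hbv ⟨q, hq⟩
    simp only at hw' hq'
    refine hred (isReducible_of_card_lt F ⟨w, hw⟩ ⟨q, hq⟩
      (W := Finset.univ.filter fun i => i ≤ ⟨w, hw⟩ ∨ i ≠ ⟨q, hq⟩ ∧ b i ≠ 0)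
      (Z := Finset.univ.filter fun i => i ≤ ⟨q, hq⟩) (Or.inr ?_) (Or.inr ?_) ?_)
    · intro i hi
      rw [Finset.mem_filter] at hi
      exact hi.2
    · intro i hi
      rw [Finset.mem_filter] at hi
      exact Or.inl hi.2
    · rw [← Finset.filter_and]
      have := add_supportCount_le_card (a := b') (p := w + 1) (r := q)
        (U := Finset.univ.filter fun i =>
          (i ≤ ⟨w, hw⟩ ∨ i ≠ ⟨q, hq⟩ ∧ b i ≠ 0) ∧ i ≤ ⟨q, hq⟩) hw hq.le (by
          intro i hi
          simp only [Finset.mem_filter, Finset.mem_univ, true_and, Fin.le_def, ← hbv, ne_eq,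
            Fin.ext_iff]
          omega)
      omega
  have hcount : ∀ (e : ℕ → ℕ) p q r, p ≤ q → q ≤ r → supportCount e p q ≤ supportCount e p r := by
    intro e p q r h1 h2
    rw [← supportCount_add e h1 h2]
    omega
  have hstep : ∀ (e : ℕ → ℕ) p q, p < q → e p = 0 →
      supportCount e p q = supportCount e (p + 1) q := by
    intro e p q h1 h2
    rw [supportCount_succ_left e h1, h2]
    simp
  obtain ⟨D, hD1, hD2⟩ := exists_dessin (K := K) (L := L) hab
    (by
      intro q w hqw hw
      rcases Nat.eq_zero_or_pos (b' q) with hb0 | hb0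
      · have h1 := supportCount_le a' q w
        rcases Nat.eq_zero_or_pos (a' w) with ha0 | ha0
        · omega
        · have := hX w (by omega) ha0
          omega
      · have ha := (hab q).resolve_right hb0.ne'
        rcases hqw.eq_or_lt with rfl | hlt
        · have := hY q (by omega) hb0
          rw [supportCount_self]
          omega
        rw [hstep a' q w hlt ha]
        rcases Nat.eq_zero_or_pos (a' w) with ha0 | ha0
        · have h1 := hY q (by omega) hb0
          have h2 := hcount a' (q + 1) w (K + L + 1) hlt (by omega)
          omega
        · have h1 := hXY q w hlt (by omega) hb0 ha0
          have h2 := hcount a' (q + 1) w (w + 1) hlt (by omega)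
          omega)
    (by
      intro w q hwq hq
      rcases Nat.eq_zero_or_pos (a' w) with ha0 | ha0
      · have h1 := supportCount_le b' w q
        rcases Nat.eq_zero_or_pos (b' q) with hb0 | hb0
        · omega
        · have := hY q (by omega) hb0
          omega
      · have hb := (hab w).resolve_left ha0.ne'
        rcases hwq.eq_or_lt with rfl | hlt
        · have := hX w (by omega) ha0
          rw [supportCount_self]
          omega
        rw [hstep b' w q hlt hb]
        rcases Nat.eq_zero_or_pos (b' q) with hb0 | hb0
        · have h1 := hX w (by omega) ha0
          have h2 := hcount b' (w + 1) q (K + L + 1) hlt (by omega)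
          omega
        · have h1 := hYX w q hlt (by omega) ha0 hb0
          omega)
    (fun w hw => add_supportCount_le (fun i hi => not_lt.1 fun h =>
      hred (isReducible_of_left F hi h)) (by omega))
    (fun q hq => add_supportCount_le (fun i hi => not_lt.1 fun h =>
      hred (isReducible_of_right F hi h)) (by omega))
    (by
      intro q w hqw hw hb0 ha0
      have h1 := hXY q w hqw (by omega) hb0 ha0
      rw [← supportCount_add a' (show q + 1 ≤ w by omega) (Nat.le_succ w),
        supportCount_succ_left a' (Nat.lt_succ_self w), if_pos ha0] at h1
      omega)
  refine ⟨D, Dessin.exponent_eq ?_ ?_ ?_ ?_⟩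
  -- At the last place the bound reads `a w + n ≤ n`, so `x_n` does not occur; the next case treats
  -- `y_n` likewise.
  · by_contra h
    have := hX (K + L) (by omega) (by rw [← Fin.val_last (K + L), hav]; omega)
    have := hav (Fin.last (K + L))
    rw [Fin.val_last] at this
    omega
  · by_contra h
    have := hY (K + L) (by omega) (by rw [← Fin.val_last (K + L), hbv]; omega)
    have := hbv (Fin.last (K + L))
    rw [Fin.val_last] at this
    omega
  · intro i hi
    rw [← hav, ← hbv]
    exact hD1 i hi
  · intro i hi
    rw [← hav, ← hbv]
    exact hD2 i hi

end Reduction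

/-! ### Rewriting along the lexicographic order -/

theorem exists_eq_sumElim {n : ℕ} (m : Vars n →₀ ℕ) :
    ∃ a b : Fin n →₀ ℕ, m = Finsupp.sumElim a b := by
  refine ⟨Finsupp.equivFunOnFinite.symm fun i => m (Sum.inl i),
    Finsupp.equivFunOnFinite.symm fun i => m (Sum.inr i), ?_⟩
  ext v
  cases v <;> rfl

theorem wellFounded_lexLT (n : ℕ) : WellFounded (LexLT (n := n)) := by
  -- The index order is reversed because the largest index decides the comparison.
  have h : WellFounded (Pi.Lex (fun i j : Fin n => j < i) fun {_} (a b : ℕ) => a < b) :=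
    Pi.Lex.wellFounded _ fun _ => wellFounded_lt
  refine Subrelation.wf ?_ (InvImage.wf
    (fun m : Vars n →₀ ℕ => (fun i => m (Sum.inl i), fun i => m (Sum.inr i)))
    (WellFounded.prod_lex h h))
  rintro a b (⟨i, h1, h2⟩ | ⟨h0, i, h1, h2⟩)
  · exact Prod.Lex.left _ _ ⟨i, h2, h1⟩
  · have : (fun i => a (Sum.inl i)) = fun i => b (Sum.inl i) := funext h0
    simp only [InvImage, this]
    exact Prod.Lex.right _ ⟨i, h2, h1⟩

/-- Solving `P(∂) f = 0` for the leading term expresses that derivative of `f` through derivatives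
by smaller monomials, and the order is well-founded. -/
theorem derivSpan_le_of_isReducible {F : Type*} [Field F] {n : ℕ} {f : MvPolynomial (Vars n) F}
    {S : Set (Vars n →₀ ℕ)} (hS : ∀ m, m ∉ S → IsReducible (annihilatorIdeal f) m) :
    derivSpan f ≤ Submodule.span F ((fun m => monomialDeriv m f) '' S) := by
  rw [derivSpan, Submodule.span_le]
  rintro _ ⟨m, rfl⟩
  simp only [SetLike.mem_coe]
  induction m using (wellFounded_lexLT n).induction with
  | _ m ih =>
    by_cases hm : m ∈ S
    · exact Submodule.subset_span ⟨m, hm, rfl⟩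
    obtain ⟨P, hP, hmP, hlt⟩ := hS m hm
    rw [mem_annihilatorIdeal, ← diffOp_eq_derivHom, diffOp, ← Finset.add_sum_erase _ _ hmP,
      LinearMap.add_apply, LinearMap.smul_apply, add_eq_zero_iff_eq_neg] at hP
    rw [← Submodule.smul_mem_iff _ (mem_support_iff.1 hmP), hP, LinearMap.sum_apply]
    refine Submodule.neg_mem _ (Submodule.sum_mem _ fun m' hm' => ?_)
    rw [Finset.mem_erase] at hm'
    exact Submodule.smul_mem _ _ (ih m' (hlt m' hm'.2 hm'.1))

end Hook

theorem mainTheorem2 (F : Type*) [Field F] [CharZero F] (K L : ℕ) :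
    Submodule.span F (Set.range fun D : Hook.Dessin K L =>
        Hook.monomialDeriv D.exponent (Hook.delta F K L)) =
      Hook.derivSpan (Hook.delta F K L) ∧
    ∀ m : Hook.Vars (K + L + 1) →₀ ℕ,
      (∀ D : Hook.Dessin K L, D.exponent ≠ m) →
        ∃ P ∈ Hook.annihilator (Hook.delta F K L), Hook.IsLexLeading P m := by
  have hred : ∀ m : Hook.Vars (K + L + 1) →₀ ℕ, (∀ D : Hook.Dessin K L, D.exponent ≠ m) →
      Hook.IsReducible (Hook.annihilatorIdeal (Hook.delta F K L)) m := by
    intro m hm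
    obtain ⟨a, b, rfl⟩ := Hook.exists_eq_sumElim m
    by_contra h
    obtain ⟨D, hD⟩ := Hook.exists_dessin_of_not_isReducible F h
    exact hm D hD
  refine ⟨le_antisymm ?_ ?_, ?_⟩
  · rw [Submodule.span_le]
    rintro _ ⟨D, rfl⟩
    exact Submodule.subset_span ⟨D.exponent, rfl⟩
  · refine (Hook.derivSpan_le_of_isReducible
      (S := Set.range fun D : Hook.Dessin K L => D.exponent) fun m hm => hred m fun D hD =>
        hm ⟨D, hD⟩).trans ?_
    rw [← Set.range_comp]
    rfl
  · intro m hm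
    obtain ⟨P, hP, hlead⟩ := hred m hm
    exact ⟨P, Hook.mem_annihilator_iff.2 hP, hlead⟩
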